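/- Let $\mathcal X,\mathcal S,\mathcal Y_1,\mathcal Y_2,\mathcal Y_3$ be finite alphabets. A discrete memoryless multilevel broadcast channel with side information is given by a law $p(s)$ on $\mathcal S$, a channel $p(y_1,y_3\mid x,s)$ and a channel $p(y_2\mid y_1)$ (so that $Y_2$ is a degraded version of $Y_1$). For block length $n$, the states $S_1,\dots,S_n$ are i.i.d. with law $p(s)$ and $$p(y_1^n,y_2^n,y_3^n\mid x^n,s^n)=\prod_{i=1}^n p(y_{1i},y_{3i}\mid x_i,s_i)\,p(y_{2i}\mid y_{1i}).$$ The side information is available non-causally at the transmitter and at all receivers: a code of length $n$ with $M_0$ common and $M_1$ private messages consists of an encoder $x^n(m_0,m_1,s^n)$ and decoders $d_1(y_1^n,s^n)\in\{1,\dots,M_0\}\times\{1,\dots,M_1\}$ and $d_2(y_2^n,s^n),\,d_3(y_3^n,s^n)\in\{1,\dots,M_0\}$. Its error probability is the average, over uniformly distributed $(m_0,m_1)$ independent of $S^n$, of the probability that $d_1\ne(m_0,m_1)$ or $d_2\ne m_0$ or $d_3\ne m_0$. A pair $(R_0,R_1)$ is $\epsilon$-achievable if for every $\xi>0$ there is an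 $n_0$ such that for all $n\ge n_0$ there is a code of length $n$ with $M_0\ge 2^{n(R_0-\xi)}$, $M_1\ge 2^{n(R_1-\xi)}$ and error probability at most $\epsilon$. The capacity region is the set of the pairs $(R_0,R_1)$ that lie, for every $\epsilon>0$, in the closure of the set of $\epsilon$-achievable pairs. Theorem. For every $(R_0,R_1)$ in the capacity region there are random variables $U,V,W$ with finite alphabets and a joint distribution $$p(u,v,w,s,x,y_1,y_2,y_3)=p(s)\,p(u,v\mid s)\,p(w\mid u,v,s)\,p(x\mid u,v,w,s)\,p(y_1,y_3\mid x,s)\,p(y_2\mid y_1)$$ (with the given $p(s)$, $p(y_1,y_3\mid x,s)$ and $p(y_2\mid y_1)$) such that \begin{align*} R_0&\le\min\{I(U;Y_2\mid S),\ I(UV;Y_3\mid S)\},\\ R_1&\le\min\{I(X;Y_1\mid US),\ I(X;Y_1\mid UVS)+I(V;Y_3\mid US)+I(U;Y_3\mid S)\},\\ R_0+R_1&\le\min\{I(X;Y_1\mid S),\ I(X;Y_1\mid UVS)+I(UV;Y_3\mid S)+I(U;Y_1\mid S)\}, \end{align*} where the mutual informations are measured in bits. -/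

import Mathlib

noncomputable section

namespace InfoTheory

/-! Information measures of finitely-valued random variables, in bits. -/

open Classical in
/-- `prob P A a` is the probability that `A = a` when the outcome has mass function `P`. -/
def prob {Ω α : Type*} [Fintype Ω] (P : Ω → ℝ) (A : Ω → α) (a : α) : ℝ :=
  ∑ ω, if A ω = a then P ω else 0

/-- The pair of random variables `(A, B)`. -/
def pair {Ω α β : Type*} (A : Ω → α) (B : Ω → β) : Ω → α × β := fun ω => (A ω, B ω)

/-- Conditional entropy `H(A | C) = - ∑ p(a, c) log₂ p(a | c)`. -/
def condEntropy {Ω α γ : Type*} [Fintype Ω] [Fintype α] [Fintype γ]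
    (P : Ω → ℝ) (A : Ω → α) (C : Ω → γ) : ℝ :=
  -∑ a, ∑ c, prob P (pair A C) (a, c) *
    Real.logb 2 (prob P (pair A C) (a, c) / prob P C c)

/-- Conditional mutual information `I(A; B | C) = H(A | C) - H(A | B, C)`. -/
def condMI {Ω α β γ : Type*} [Fintype Ω] [Fintype α] [Fintype β] [Fintype γ]
    (P : Ω → ℝ) (A : Ω → α) (B : Ω → β) (C : Ω → γ) : ℝ :=
  condEntropy P A C - condEntropy P A (pair B C)

end InfoTheory

/-- A discrete memoryless multilevel broadcast channel with side information: the law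
`p(s)` of the state, the channel `p(y₁, y₃ | x, s)`, and the degrading channel `p(y₂ | y₁)`. -/
structure MultilevelBC (X S Y₁ Y₂ Y₃ : Type*)
    [Fintype S] [Fintype Y₁] [Fintype Y₂] [Fintype Y₃] where
  pS : S → ℝ
  pS_mem : pS ∈ stdSimplex ℝ S
  p13 : X → S → Y₁ × Y₃ → ℝ
  p13_mem : ∀ x s, p13 x s ∈ stdSimplex ℝ (Y₁ × Y₃)
  p2 : Y₁ → Y₂ → ℝ
  p2_mem : ∀ y₁, p2 y₁ ∈ stdSimplex ℝ Y₂

/-- A block code of length `n` with `M₀` common and `M₁` private messages, where the whole state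
sequence is known at the encoder and at all the decoders. -/
structure MultilevelCode (X S Y₁ Y₂ Y₃ : Type*) (n M₀ M₁ : ℕ) where
  enc : Fin M₀ → Fin M₁ → (Fin n → S) → (Fin n → X)
  dec₁ : (Fin n → Y₁) → (Fin n → S) → Fin M₀ × Fin M₁
  dec₂ : (Fin n → Y₂) → (Fin n → S) → Fin M₀
  dec₃ : (Fin n → Y₃) → (Fin n → S) → Fin M₀

/-- The conditional laws `p(u, v | s)`, `p(w | u, v, s)` and `p(x | u, v, w, s)`. -/
structure AuxLaw (S X U V W : Type*) [Fintype X] [Fintype U] [Fintype V] [Fintype W] where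
  pUV : S → U × V → ℝ
  pUV_mem : ∀ s, pUV s ∈ stdSimplex ℝ (U × V)
  pW : U → V → S → W → ℝ
  pW_mem : ∀ u v s, pW u v s ∈ stdSimplex ℝ W
  pX : U → V → W → S → X → ℝ
  pX_mem : ∀ u v w s, pX u v w s ∈ stdSimplex ℝ X

/-- The tuples `(u, v, w, s, x, y₁, y₂, y₃)`. -/
abbrev Outcome (U V W S X Y₁ Y₂ Y₃ : Type*) := U × V × W × S × X × Y₁ × Y₂ × Y₃

namespace Outcome

variable {U V W S X Y₁ Y₂ Y₃ : Type*}

/-- The random variable `U`. -/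
def u : Outcome U V W S X Y₁ Y₂ Y₃ → U := fun (u, _, _, _, _, _, _, _) => u
/-- The random variable `V`. -/
def v : Outcome U V W S X Y₁ Y₂ Y₃ → V := fun (_, v, _, _, _, _, _, _) => v
/-- The random variable `S`. -/
def s : Outcome U V W S X Y₁ Y₂ Y₃ → S := fun (_, _, _, s, _, _, _, _) => s
/-- The random variable `X`. -/
def x : Outcome U V W S X Y₁ Y₂ Y₃ → X := fun (_, _, _, _, x, _, _, _) => x
/-- The random variable `Y₁`. -/
def y₁ : Outcome U V W S X Y₁ Y₂ Y₃ → Y₁ := fun (_, _, _, _, _, y₁, _, _) => y₁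
/-- The random variable `Y₂`. -/
def y₂ : Outcome U V W S X Y₁ Y₂ Y₃ → Y₂ := fun (_, _, _, _, _, _, y₂, _) => y₂
/-- The random variable `Y₃`. -/
def y₃ : Outcome U V W S X Y₁ Y₂ Y₃ → Y₃ := fun (_, _, _, _, _, _, _, y₃) => y₃

end Outcome

namespace MultilevelBC

variable {X S Y₁ Y₂ Y₃ : Type*} [Fintype S] [Fintype Y₁] [Fintype Y₂] [Fintype Y₃]

/-- `p(sⁿ) = ∏ p(sᵢ)`. -/
def pSn (ch : MultilevelBC X S Y₁ Y₂ Y₃) {n : ℕ} (s : Fin n → S) : ℝ := ∏ i, ch.pS (s i)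

/-- `p(y₁ⁿ, y₂ⁿ, y₃ⁿ | xⁿ, sⁿ) = ∏ p(y₁ᵢ, y₃ᵢ | xᵢ, sᵢ) p(y₂ᵢ | y₁ᵢ)`. -/
def pYn (ch : MultilevelBC X S Y₁ Y₂ Y₃) {n : ℕ} (x : Fin n → X) (s : Fin n → S)
    (y₁ : Fin n → Y₁) (y₂ : Fin n → Y₂) (y₃ : Fin n → Y₃) : ℝ :=
  ∏ i, ch.p13 (x i) (s i) (y₁ i, y₃ i) * ch.p2 (y₁ i) (y₂ i)

open Classical in
/-- The probability of a decoding error at some receiver, averaged over the messages. -/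
def errorProb (ch : MultilevelBC X S Y₁ Y₂ Y₃) {n M₀ M₁ : ℕ}
    (c : MultilevelCode X S Y₁ Y₂ Y₃ n M₀ M₁) : ℝ :=
  1 / ((M₀ : ℝ) * (M₁ : ℝ)) * ∑ m₀ : Fin M₀, ∑ m₁ : Fin M₁, ∑ s : Fin n → S,
    ch.pSn s * ∑ y₁ : Fin n → Y₁, ∑ y₂ : Fin n → Y₂, ∑ y₃ : Fin n → Y₃,
      if c.dec₁ y₁ s ≠ (m₀, m₁) ∨ c.dec₂ y₂ s ≠ m₀ ∨ c.dec₃ y₃ s ≠ m₀ then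
        ch.pYn (c.enc m₀ m₁ s) s y₁ y₂ y₃
      else 0

/-- `(R₀, R₁)` is `ε`-achievable: for every `ξ > 0` and all large `n` there is a code of length `n`
with at least `2 ^ (n (R₀ - ξ))` common and at least `2 ^ (n (R₁ - ξ))` private messages and error
probability at most `ε`. -/
def EpsAchievable (ch : MultilevelBC X S Y₁ Y₂ Y₃) (ε : ℝ) (R : ℝ × ℝ) : Prop :=
  ∀ ξ : ℝ, 0 < ξ → ∃ n₀ : ℕ, ∀ n : ℕ, n₀ ≤ n → ∃ M₀ M₁ : ℕ,
    (2 : ℝ) ^ ((n : ℝ) * (R.1 - ξ)) ≤ (M₀ : ℝ) ∧ (2 : ℝ) ^ ((n : ℝ) * (R.2 - ξ)) ≤ (M₁ : ℝ) ∧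
    ∃ c : MultilevelCode X S Y₁ Y₂ Y₃ n M₀ M₁, ch.errorProb c ≤ ε

/-- The capacity region: the rate pairs that lie, for every `ε > 0`, in the closure of the set of
`ε`-achievable pairs. -/
def capacityRegion (ch : MultilevelBC X S Y₁ Y₂ Y₃) : Set (ℝ × ℝ) :=
  {R | ∀ ε : ℝ, 0 < ε → R ∈ closure {R' | ch.EpsAchievable ε R'}}

/-- The joint law `p(s) p(u, v | s) p(w | u, v, s) p(x | u, v, w, s) p(y₁, y₃ | x, s) p(y₂ | y₁)`. -/
def joint (ch : MultilevelBC X S Y₁ Y₂ Y₃) {U V W : Type*} [Fintype X] [Fintype U] [Fintype V]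
    [Fintype W] (q : AuxLaw S X U V W) : Outcome U V W S X Y₁ Y₂ Y₃ → ℝ :=
  fun (u, v, w, s, x, y₁, y₂, y₃) =>
    ch.pS s * q.pUV s (u, v) * q.pW u v s w * q.pX u v w s x * ch.p13 x s (y₁, y₃) * ch.p2 y₁ y₂

end MultilevelBC

end

/-! The state sequence is known everywhere, so once it is fixed to a value `σ` the code is an
ordinary broadcast code over the time-varying memoryless channels `ch.outChan (σ i)`. For it
`block_converse` runs the classical converse. Let U_i be the common message with the past of (Y₁,
Y₂), and V_i the future of Y₃. Fano's inequality and the chain rule bound the two rates. Csiszár's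
sum identity exchanges past and future, giving the sum rate at most the sum over i of I(U_iV_i; Y₃ᵢ)
+ I(X_i; Y₁ᵢ | U_iV_i). Carrying Y₂ along with Y₁ makes Y₂ a function of the observation, and costs
nothing in the end by degradedness (`chanMI_degraded`).

Every information here depends only on the input law and on four averages: of the mutual information
and the Y₂-entropy over the laws of X given U, and of the mutual information and the Y₃-entropy over
the laws of X given UV. The tuples that auxiliary variables can produce form an iterated convex
hull, `outerHull`. Since it is convex and each bound is concave on it, the tuples of all times and
all state sequences sharing a state average to one tuple per state (`exists_concave_average`,
`code_converse`); this replaces a time-sharing variable. Since it is compact (Carathéodory), the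
limit of vanishing error and rate slack exists in it, and no bound on the alphabets is needed
(`exists_stateHull_of_mem_capacityRegion`). Unfolding the two convex combinations of a hull point
gives finite U and V and the law of X given them (`exists_laws_of_mem_outerHull`); W is trivial.

Five inequalities then suffice. The second bound on R₁ follows from the Csiszár sum-rate bound
because the common rate may be taken nonnegative, and the second bound on R₀ + R₁ holds even without
its term I(U; Y₁ | S). -/

set_option linter.unusedSectionVars false

noncomputable section

namespace InfoTheory

open Real

variable {Ω α β γ δ : Type*} [Fintype Ω]

/-! ### Laws of random variables on a finite space. -/

section Prob

lemma prob_eq_sum [DecidableEq α] (P : Ω → ℝ) (A : Ω → α) (a : α) :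
    prob P A a = ∑ ω, if A ω = a then P ω else 0 := by
  unfold prob
  exact Finset.sum_congr rfl fun ω _ => by congr

lemma sum_prob_mul [Fintype α] (P : Ω → ℝ) (A : Ω → α) (f : α → ℝ) :
    ∑ a, prob P A a * f a = ∑ ω, P ω * f (A ω) := by
  classical
  simp only [prob_eq_sum, Finset.sum_mul]
  rw [Finset.sum_comm]
  simp [ite_mul]

lemma sum_prob [Fintype α] (P : Ω → ℝ) (A : Ω → α) : ∑ a, prob P A a = ∑ ω, P ω := by
  simpa using sum_prob_mul P A fun _ => 1

lemma prob_nonneg {P : Ω → ℝ} (hP : ∀ ω, 0 ≤ P ω) (A : Ω → α) (a : α) : 0 ≤ prob P A a := by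
  classical
  rw [prob_eq_sum]
  exact Finset.sum_nonneg fun ω _ => by split_ifs <;> simp [hP]

lemma prob_mem_stdSimplex [Fintype α] {P : Ω → ℝ} (hP : P ∈ stdSimplex ℝ Ω) (A : Ω → α) :
    prob P A ∈ stdSimplex ℝ α :=
  ⟨prob_nonneg hP.1 A, (sum_prob P A).trans hP.2⟩

lemma le_prob {P : Ω → ℝ} (hP : ∀ ω, 0 ≤ P ω) (A : Ω → α) (ω : Ω) : P ω ≤ prob P A (A ω) := by
  classical
  rw [prob_eq_sum]
  have := Finset.single_le_sum (f := fun ω' => if A ω' = A ω then P ω' else 0)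
    (fun ω' _ => by split_ifs <;> simp [hP]) (Finset.mem_univ ω)
  simpa using this

lemma prob_congr (P : Ω → ℝ) {A : Ω → α} {B : Ω → β} (h : ∀ ω ω', A ω = A ω' ↔ B ω = B ω')
    (ω : Ω) : prob P A (A ω) = prob P B (B ω) := by
  classical
  simp only [prob_eq_sum, h]

lemma prob_comp [Fintype α] [DecidableEq β] (P : Ω → ℝ) (A : Ω → α) (f : α → β) (b : β) :
    prob P (fun ω => f (A ω)) b = ∑ a, if f a = b then prob P A a else 0 := by
  have h := sum_prob_mul P A fun a => if f a = b then 1 else 0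
  simp only [mul_ite, mul_one, mul_zero] at h
  rw [h, prob_eq_sum]

lemma sum_prob_pair_left [Fintype α] (P : Ω → ℝ) (A : Ω → α) (C : Ω → γ) (c : γ) :
    ∑ a, prob P (pair A C) (a, c) = prob P C c := by
  classical
  simp only [prob_eq_sum]
  rw [Finset.sum_comm]
  refine Finset.sum_congr rfl fun ω _ => ?_
  by_cases h : C ω = c <;> simp [pair, h]

lemma sum_prob_pair_right [Fintype γ] (P : Ω → ℝ) (A : Ω → α) (C : Ω → γ) (a : α) :
    ∑ c, prob P (pair A C) (a, c) = prob P A a := by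
  classical
  simp only [prob_eq_sum]
  rw [Finset.sum_comm]
  refine Finset.sum_congr rfl fun ω _ => ?_
  by_cases h : A ω = a <;> simp [pair, h]

lemma prob_pair_le [Fintype α] {P : Ω → ℝ} (hP : ∀ ω, 0 ≤ P ω) (A : Ω → α) (C : Ω → γ) (a : α) (c : γ) :
    prob P (pair A C) (a, c) ≤ prob P C c := by
  rw [← sum_prob_pair_left P A C c]
  exact Finset.single_le_sum (f := fun a => prob P (pair A C) (a, c))
    (fun a _ => prob_nonneg hP _ _) (Finset.mem_univ a)

lemma prob_pair_le_left [Fintype γ] {P : Ω → ℝ} (hP : ∀ ω, 0 ≤ P ω) (A : Ω → α) (C : Ω → γ) (a : α) (c : γ) :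
    prob P (pair A C) (a, c) ≤ prob P A a := by
  rw [← sum_prob_pair_right P A C a]
  exact Finset.single_le_sum (f := fun c => prob P (pair A C) (a, c))
    (fun c _ => prob_nonneg hP _ _) (Finset.mem_univ c)

end Prob

/-! ### Entropy inequalities, in nats. -/

variable [Fintype α] [Fintype β] [Fintype γ] [Fintype δ]

/-- The entropy, in nats, of a mass function. -/
def massEnt (p : α → ℝ) : ℝ := ∑ a, negMulLog (p a)

/-- The entropy of a random variable, in nats. -/
def Ent (P : Ω → ℝ) (A : Ω → α) : ℝ := massEnt (prob P A)

lemma ent_eq_sum (P : Ω → ℝ) (A : Ω → α) :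
    Ent P A = ∑ ω, P ω * -log (prob P A (A ω)) := by
  rw [← sum_prob_mul P A fun a => -log (prob P A a)]
  exact Finset.sum_congr rfl fun a _ => by rw [negMulLog]; ring

/-- Entropy sees only the partition of `Ω` that a variable induces. This is what allows tuples to be
regrouped, reordered and stripped of redundant entries below. -/
lemma ent_congr (P : Ω → ℝ) {A : Ω → α} {B : Ω → β} (h : ∀ ω ω', A ω = A ω' ↔ B ω = B ω') :
    Ent P A = Ent P B := by
  simp only [ent_eq_sum, prob_congr P h]

lemma ent_pair_sub_eq (P : Ω → ℝ) (A : Ω → α) (C : Ω → γ) :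
    Ent P (pair A C) - Ent P C =
      ∑ ω, P ω * (log (prob P C (C ω)) - log (prob P (pair A C) (A ω, C ω))) := by
  rw [ent_eq_sum, ent_eq_sum, ← Finset.sum_sub_distrib]
  exact Finset.sum_congr rfl fun ω _ => by simp only [pair]; ring

/-- Gibbs' inequality for conditional entropies. -/
lemma ent_pair_sub_le {P : Ω → ℝ} (hP : ∀ ω, 0 ≤ P ω) (A : Ω → α) (C : Ω → γ) (q : α → γ → ℝ)
    (hq0 : ∀ a c, 0 ≤ q a c) (hq1 : ∀ c, ∑ a, q a c ≤ 1)
    (hq : ∀ ω, 0 < P ω → 0 < q (A ω) (C ω)) :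
    Ent P (pair A C) - Ent P C ≤ ∑ ω, P ω * -log (q (A ω) (C ω)) := by
  rw [ent_pair_sub_eq, ← sub_nonpos, ← Finset.sum_sub_distrib]
  set r : α × γ → ℝ := fun x => prob P (pair A C) x
  have key : ∀ ω, P ω * (log (prob P C (C ω)) - log (r (A ω, C ω))) -
      P ω * -log (q (A ω) (C ω)) ≤
      P ω * (q (A ω) (C ω) * prob P C (C ω) / r (A ω, C ω) - 1) := by
    intro ω
    rcases (hP ω).eq_or_lt with h | h
    · simp [← h]
    · have h1 : 0 < r (A ω, C ω) := h.trans_le (le_prob hP (pair A C) ω)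
      have h2 : 0 < prob P C (C ω) := h.trans_le (le_prob hP C ω)
      have h3 := hq ω h
      have h4 := log_le_sub_one_of_pos (div_pos (mul_pos h3 h2) h1)
      rw [log_div (mul_pos h3 h2).ne' h1.ne', log_mul h3.ne' h2.ne'] at h4
      rw [← mul_sub]
      exact mul_le_mul_of_nonneg_left (by linarith) h.le
  refine (Finset.sum_le_sum fun ω _ => key ω).trans ?_
  simp only [mul_sub, mul_one, Finset.sum_sub_distrib]
  rw [sub_nonpos]
  have h5 := sum_prob_mul P (pair A C) fun x => q x.1 x.2 * prob P C x.2 / r x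
  simp only [pair] at h5
  rw [← h5, ← sum_prob P C, Fintype.sum_prod_type_right]
  refine Finset.sum_le_sum fun c _ => ?_
  calc ∑ a, prob P (fun ω => (A ω, C ω)) (a, c) * (q a c * prob P C c / r (a, c))
      ≤ ∑ a, q a c * prob P C c := by
        refine Finset.sum_le_sum fun a _ => ?_
        change r (a, c) * _ ≤ _
        have h6 := mul_nonneg (hq0 a c) (prob_nonneg hP C c)
        by_cases h : r (a, c) = 0
        · simpa [h] using h6
        · rw [mul_div_cancel₀ _ h]
    _ ≤ prob P C c := by
        rw [← Finset.sum_mul]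
        exact mul_le_of_le_one_left (prob_nonneg hP C c) (hq1 c)

/-- Conditioning reduces entropy. -/
lemma ent_submodular {P : Ω → ℝ} (hP : ∀ ω, 0 ≤ P ω) (A : Ω → α) (B : Ω → β) (C : Ω → γ) :
    Ent P (pair A (pair B C)) - Ent P (pair B C) ≤ Ent P (pair A C) - Ent P C := by
  refine (ent_pair_sub_le hP A (pair B C)
    (fun a x => prob P (pair A C) (a, x.2) / prob P C x.2) ?_ ?_ ?_).trans_eq ?_
  · exact fun a c => div_nonneg (prob_nonneg hP _ _) (prob_nonneg hP _ _)
  · intro c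
    rw [← Finset.sum_div, sum_prob_pair_left]
    exact div_self_le_one _
  · exact fun ω h => div_pos (h.trans_le (le_prob hP (pair A C) ω)) (h.trans_le (le_prob hP C ω))
  · rw [ent_pair_sub_eq]
    refine Finset.sum_congr rfl fun ω _ => ?_
    rcases (hP ω).eq_or_lt with h | h
    · simp [← h]
    · have h1 := h.trans_le (le_prob hP (pair A C) ω)
      have h2 := h.trans_le (le_prob hP C ω)
      simp only [pair] at h1 ⊢
      rw [log_div h1.ne' h2.ne']
      ring

/-- Subadditivity of entropy. -/
lemma ent_pair_le {P : Ω → ℝ} (hP : P ∈ stdSimplex ℝ Ω) (A : Ω → α) (C : Ω → γ) :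
    Ent P (pair A C) - Ent P C ≤ Ent P A := by
  have h := ent_submodular hP.1 A C (fun _ => ())
  have h1 : Ent P (pair A (pair C fun _ => ())) = Ent P (pair A C) :=
    ent_congr P fun ω ω' => by simp [pair]
  have h2 : Ent P (pair C fun _ => ()) = Ent P C := ent_congr P fun ω ω' => by simp [pair]
  have h3 : Ent P (pair A fun _ => ()) = Ent P A := ent_congr P fun ω ω' => by simp [pair]
  have h4 : Ent P (fun _ => ()) = 0 := by simp [Ent, massEnt, prob, hP.2]
  rw [h1, h2, h3, h4] at h
  linarith

/-- Fano's inequality. -/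
lemma ent_fano {P : Ω → ℝ} (hP : P ∈ stdSimplex ℝ Ω) (A : Ω → α) (C : Ω → γ) (g : γ → α)
    (e : ℝ) (he : ∑ ω, (open Classical in if g (C ω) = A ω then 0 else P ω) ≤ e) :
    Ent P (pair A C) - Ent P C ≤ log 2 + e * log (Fintype.card α) := by
  classical
  rcases isEmpty_or_nonempty Ω with hΩ | ⟨⟨ω₀⟩⟩
  · have := hP.2; simp at this
  have hcard : (1 : ℝ) ≤ Fintype.card α := by
    exact_mod_cast Fintype.card_pos_iff.2 ⟨A ω₀⟩
  have hcard0 : (0 : ℝ) < Fintype.card α := by linarith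
  -- The test kernel puts mass 1/2 on the guess and spreads another 1/2 uniformly over the alphabet.
  -- A correct guess costs log 2, and an error costs log |α| more.
  refine (ent_pair_sub_le hP.1 A C
    (fun a c => if g c = a then 1 / 2 else 1 / (2 * Fintype.card α)) ?_ ?_ ?_).trans ?_
  · intro a c; split_ifs <;> positivity
  · intro c
    calc ∑ a, (if g c = a then (1 : ℝ) / 2 else 1 / (2 * Fintype.card α))
        ≤ ∑ a, ((if g c = a then (1 : ℝ) / 2 else 0) + 1 / (2 * Fintype.card α)) := by
          refine Finset.sum_le_sum fun a _ => ?_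
          split_ifs
          · linarith [show (0 : ℝ) ≤ 1 / (2 * Fintype.card α) by positivity]
          · simp
      _ = 1 := by
          rw [Finset.sum_add_distrib]
          simp only [Finset.sum_ite_eq, Finset.mem_univ, if_true, Finset.sum_const,
            Finset.card_univ, nsmul_eq_mul]
          field_simp; norm_num
  · intro ω _; split_ifs <;> positivity
  · have h1 : ∀ ω, P ω * -log (if g (C ω) = A ω then (1 : ℝ) / 2 else 1 / (2 * Fintype.card α)) =
        P ω * log 2 + (if g (C ω) = A ω then 0 else P ω) * log (Fintype.card α) := by
      intro ω
      split_ifs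
      · rw [one_div, log_inv]; ring
      · rw [one_div, log_inv, log_mul two_ne_zero hcard0.ne']; ring
    rw [Finset.sum_congr rfl fun ω _ => h1 ω, Finset.sum_add_distrib, ← Finset.sum_mul,
      ← Finset.sum_mul, hP.2, one_mul]
    have h2 := mul_le_mul_of_nonneg_right he (log_nonneg hcard)
    gcongr

/-- The entropy of the output of a channel. -/
lemma ent_pair_of_channel (P : Ω → ℝ) (A : Ω → α) (B : Ω → β) (k : α → β → ℝ)
    (hk : ∀ a, ∑ b, k a b = 1)
    (h : ∀ a b, prob P (pair B A) (b, a) = prob P A a * k a b) :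
    Ent P (pair B A) - Ent P A = ∑ a, prob P A a * massEnt (k a) := by
  simp only [Ent, massEnt]
  rw [Fintype.sum_prod_type_right, ← Finset.sum_sub_distrib]
  refine Finset.sum_congr rfl fun a _ => ?_
  simp only [h, negMulLog_mul]
  rw [Finset.sum_add_distrib, ← Finset.sum_mul, hk, ← Finset.mul_sum]
  ring

/-- The law of the output of the channel `T` under the input law `p`. -/
def outLaw (T : α → β → ℝ) (p : α → ℝ) : β → ℝ := fun b => ∑ a, p a * T a b

/-- The entropy of the output given an observation `C` of the input `X` only. -/
lemma ent_pair_of_markov {P : Ω → ℝ} (hP : ∀ ω, 0 ≤ P ω) (X : Ω → α) (Y : Ω → β) (C : Ω → γ)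
    (T : α → β → ℝ)
    (h : ∀ b a c, prob P (pair Y (pair X C)) (b, a, c) = prob P (pair X C) (a, c) * T a b) :
    Ent P (pair Y C) - Ent P C = ∑ c, prob P C c *
      massEnt (outLaw T fun a => prob P (pair X C) (a, c) / prob P C c) := by
  have hYC : ∀ b c, prob P (pair Y C) (b, c) = ∑ a, prob P (pair X C) (a, c) * T a b := by
    intro b c
    simp only [← h]
    rw [← sum_prob_pair_left P X (pair Y C)]
    refine Finset.sum_congr rfl fun a _ => ?_
    classical
    simp only [prob_eq_sum, pair, Prod.mk.injEq]
    refine Finset.sum_congr rfl fun ω _ => ?_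
    congr 1
    simp only [eq_iff_iff]; tauto
  simp only [Ent, massEnt]
  rw [Fintype.sum_prod_type_right, ← Finset.sum_sub_distrib]
  refine Finset.sum_congr rfl fun c _ => ?_
  by_cases hc : prob P C c = 0
  · have h0 : ∀ b, prob P (pair Y C) (b, c) = 0 := fun b =>
      le_antisymm ((prob_pair_le hP Y C b c).trans_eq hc) (prob_nonneg hP _ _)
    simp [h0, hc]
  · set k : β → ℝ := outLaw T fun a => prob P (pair X C) (a, c) / prob P C c
    have h1 : ∀ b, prob P (pair Y C) (b, c) = prob P C c * k b := by
      intro b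
      simp only [hYC, k, outLaw, Finset.mul_sum]
      refine Finset.sum_congr rfl fun a _ => ?_
      field_simp
    have h2 : ∑ b, k b = 1 := by
      have := sum_prob_pair_left P Y C c
      simp only [h1, ← Finset.mul_sum] at this
      exact mul_left_cancel₀ hc (this.trans (mul_one _).symm)
    simp only [h1, negMulLog_mul]
    rw [Finset.sum_add_distrib, ← Finset.sum_mul, h2, ← Finset.mul_sum]
    ring

lemma condEntropy_eq {P : Ω → ℝ} (hP : ∀ ω, 0 ≤ P ω) (A : Ω → α) (C : Ω → γ) :
    condEntropy P A C = (Ent P (pair A C) - Ent P C) / log 2 := by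
  have h1 : condEntropy P A C = -(∑ x, prob P (pair A C) x *
      ((log (prob P (pair A C) x) - log (prob P C x.2)) / log 2)) := by
    rw [condEntropy, Fintype.sum_prod_type]
    congr 1
    refine Finset.sum_congr rfl fun a _ => Finset.sum_congr rfl fun c _ => ?_
    by_cases h : prob P (pair A C) (a, c) = 0
    · simp [h]
    · have h2 : prob P C c ≠ 0 := fun h0 => h <|
        le_antisymm ((prob_pair_le hP A C a c).trans_eq h0) (prob_nonneg hP _ _)
      rw [logb, log_div h h2]
  rw [h1, sum_prob_mul P (pair A C) fun x =>
    (log (prob P (pair A C) x) - log (prob P C x.2)) / log 2, ent_pair_sub_eq,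
    ← Finset.sum_neg_distrib, Finset.sum_div]
  refine Finset.sum_congr rfl fun ω _ => ?_
  simp only [pair]
  ring

/-- `I(A; B | C) = H(B | C) - H(B | A, C)`. -/
lemma condMI_mul_log_two {P : Ω → ℝ} (hP : ∀ ω, 0 ≤ P ω) (A : Ω → α) (B : Ω → β) (C : Ω → γ) :
    condMI P A B C * log 2 = (Ent P (pair B C) - Ent P C) -
      (Ent P (pair B (pair A C)) - Ent P (pair A C)) := by
  have h2 : log 2 ≠ 0 := (log_pos one_lt_two).ne'
  have h3 : Ent P (pair A (pair B C)) = Ent P (pair B (pair A C)) :=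
    ent_congr P fun ω ω' => by simp only [pair, Prod.mk.injEq]; tauto
  rw [condMI, condEntropy_eq hP, condEntropy_eq hP, h3]
  field_simp
  ring

lemma condMI_nonneg {P : Ω → ℝ} (hP : ∀ ω, 0 ≤ P ω) (A : Ω → α) (B : Ω → β) (C : Ω → γ) :
    0 ≤ condMI P A B C := by
  have h := condMI_mul_log_two hP A B C
  have h1 := ent_submodular hP B A C
  exact nonneg_of_mul_nonneg_left (h ▸ sub_nonneg.2 h1) (log_pos one_lt_two)

/-- Chain rule of mutual information. -/
lemma condMI_chain {P : Ω → ℝ} (hP : ∀ ω, 0 ≤ P ω) (U : Ω → α) (V : Ω → β) (Y : Ω → γ)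
    (S : Ω → δ) :
    condMI P V Y (pair U S) + condMI P U Y S = condMI P (pair U V) Y S := by
  have h2 : log 2 ≠ 0 := (log_pos one_lt_two).ne'
  have h3 : Ent P (pair Y (pair V (pair U S))) = Ent P (pair Y (pair (pair U V) S)) :=
    ent_congr P fun ω ω' => by simp only [pair, Prod.mk.injEq]; tauto
  have h4 : Ent P (pair V (pair U S)) = Ent P (pair (pair U V) S) :=
    ent_congr P fun ω ω' => by simp only [pair, Prod.mk.injEq]; tauto
  refine mul_right_cancel₀ h2 ?_
  rw [add_mul, condMI_mul_log_two hP, condMI_mul_log_two hP, condMI_mul_log_two hP, h3, h4]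
  ring

/-! ### Convex hulls: padded combinations and compactness. -/

section Convexity

variable {E : Type*} [AddCommGroup E] [Module ℝ E]

/-- Conditional laws given a null event are divisions by zero and need not be laws, so membership is
demanded only where the weight is nonzero. -/
lemma sum_smul_mem_of_ne_zero {ι : Type*} [Fintype ι] {s : Set E} (hs : Convex ℝ s) {w : ι → ℝ}
    {z : ι → E} (h0 : ∀ i, 0 ≤ w i) (h1 : ∑ i, w i = 1) (hz : ∀ i, w i ≠ 0 → z i ∈ s) :
    ∑ i, w i • z i ∈ s := by
  classical
  have h2 : ∑ i ∈ Finset.univ.filter (fun i => w i ≠ 0), w i • z i = ∑ i, w i • z i := by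
    refine Finset.sum_filter_of_ne fun i _ h h' => h (by rw [h', zero_smul])
  rw [← h2]
  refine hs.sum_mem (fun i _ => h0 i) ?_ fun i hi => hz i (Finset.mem_filter.1 hi).2
  rw [Finset.sum_filter_ne_zero, h1]

lemma exists_seq_of_mem_convexHull {s : Set E} {x : E} (hx : x ∈ convexHull ℝ s) :
    ∃ (n : ℕ) (w : ℕ → ℝ) (z : ℕ → E), (∀ m, 0 ≤ w m) ∧ (∀ m, n ≤ m → w m = 0) ∧
      (∑ m ∈ Finset.range n, w m = 1) ∧ (∀ m, z m ∈ s) ∧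
      ∑ m ∈ Finset.range n, w m • z m = x := by
  obtain ⟨z₀, hz₀⟩ : s.Nonempty := convexHull_nonempty_iff.1 ⟨x, hx⟩
  obtain ⟨ι, _, w, z, hw0, hw1, hz, rfl⟩ := mem_convexHull_iff_exists_fintype.1 hx
  have e := Fintype.equivFin ι
  -- Beyond the original indices the weight is 0 and the point is `z₀`, which keeps the padded
  -- points in `s`; this lets several combinations share one index set.
  refine ⟨Fintype.card ι, fun m => if h : m < Fintype.card ι then w (e.symm ⟨m, h⟩) else 0,
    fun m => if h : m < Fintype.card ι then z (e.symm ⟨m, h⟩) else z₀, ?_, ?_, ?_, ?_, ?_⟩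
  · intro m; dsimp only; split_ifs <;> simp [hw0]
  · intro m hm; simp [not_lt.2 hm]
  · rw [Finset.sum_range, ← hw1, ← e.symm.sum_comp]
    simp
  · intro m; dsimp only; split_ifs <;> simp [hz, hz₀]
  · rw [Finset.sum_range, ← e.symm.sum_comp]
    simp

/-- Points of finitely many convex hulls are convex combinations with a common index set. -/
lemma exists_fin_of_mem_convexHull {ι : Type*} [Fintype ι] {s : ι → Set E} {x : ι → E}
    (hx : ∀ i, x i ∈ convexHull ℝ (s i)) :
    ∃ (k : ℕ) (w : ι → Fin k → ℝ) (z : ι → Fin k → E), (∀ i, w i ∈ stdSimplex ℝ (Fin k)) ∧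
      (∀ i j, z i j ∈ s i) ∧ ∀ i, ∑ j, w i j • z i j = x i := by
  choose n w z h0 hn h1 hz hx using fun i => exists_seq_of_mem_convexHull (hx i)
  have hsub : ∀ i, Finset.range (n i) ⊆ Finset.range (Finset.univ.sup n) := fun i =>
    Finset.range_mono (Finset.le_sup (f := n) (Finset.mem_univ i))
  refine ⟨Finset.univ.sup n, fun i j => w i j, fun i j => z i j, fun i => ⟨fun j => h0 i j, ?_⟩,
    fun i j => hz i j, fun i => ?_⟩
  · rw [← h1 i, ← Finset.sum_range (w i)]
    exact (Finset.sum_subset (hsub i) fun m _ hm => hn i m (by simpa using hm)).symm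
  · rw [← hx i, ← Finset.sum_range fun m => w i m • z i m]
    exact (Finset.sum_subset (hsub i) fun m _ hm => by rw [hn i m (by simpa using hm), zero_smul]).symm

/-- In finite dimension, the convex hull of a compact set is compact. -/
lemma isCompact_convexHull {E : Type*} [NormedAddCommGroup E] [NormedSpace ℝ E]
    [FiniteDimensional ℝ E] {s : Set E} (hs : IsCompact s) : IsCompact (convexHull ℝ s) := by
  -- By Carathéodory `d` points always suffice, so the hull is the continuous image of a compact
  -- product.
  set d := Module.finrank ℝ E + 1
  have h1 : convexHull ℝ s = (fun q : (Fin d → ℝ) × (Fin d → E) => ∑ i, q.1 i • q.2 i) ''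
      (stdSimplex ℝ (Fin d) ×ˢ Set.univ.pi fun _ => s) := by
    refine Set.Subset.antisymm ?_ ?_
    · rw [convexHull_eq_union]
      simp only [Set.iUnion_subset_iff]
      intro t hts hti x hx
      have htne : (t : Set E).Nonempty := convexHull_nonempty_iff.1 ⟨x, hx⟩
      have hcard : Fintype.card t ≤ Fintype.card (Fin d) := by
        rw [Fintype.card_fin]
        exact hti.card_le_finrank_succ.trans
          (Nat.succ_le_succ (Submodule.finrank_le _))
      obtain ⟨e⟩ := Function.Embedding.nonempty_of_card_le hcard
      have : Nonempty t := htne.to_subtype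
      -- There may be fewer than `d` vertices; the left inverse of the embedding repeats some of
      -- them to fill `Fin d`.
      set z : Fin d → E := fun i => (Function.invFun e i : t)
      have hz : ∀ i, z i ∈ s := fun i => hts (Function.invFun e i).2
      have hx' : x ∈ convexHull ℝ (Set.range z) := by
        refine convexHull_mono ?_ hx
        intro y hy
        exact ⟨e ⟨y, hy⟩, by simp [z, Function.leftInverse_invFun e.injective _]⟩
      have hr : Set.range z = Fintype.linearCombination ℝ z ''
          Set.range fun i : Fin d => (Pi.single i 1 : Fin d → ℝ) := by
        rw [← Set.range_comp]
        congr 1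
        funext i
        simp [Fintype.linearCombination_apply_single]
      rw [hr, ← LinearMap.image_convexHull, convexHull_rangle_single_eq_stdSimplex] at hx'
      obtain ⟨w, hw, rfl⟩ := hx'
      exact ⟨(w, z), ⟨hw, fun i _ => hz i⟩, rfl⟩
    · rintro _ ⟨⟨w, z⟩, ⟨hw, hz⟩, rfl⟩
      exact (convex_convexHull ℝ s).sum_mem (fun i _ => hw.1 i) hw.2
        fun i _ => subset_convexHull ℝ s (hz i trivial)
  rw [h1]
  exact ((isCompact_stdSimplex ℝ _).prod (isCompact_univ_pi fun _ => hs)).image (by fun_prop)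

end Convexity

/-! ### Output entropy and mutual information as functions of the input law. -/

section Channel

variable {α β γ : Type*} [Fintype α] [Fintype β] [Fintype γ]

/-- The mutual information, in nats, of the input and the output of the channel `T` under the
input law `p`. -/
def chanMI (T : α → β → ℝ) (p : α → ℝ) : ℝ := massEnt (outLaw T p) - ∑ a, p a * massEnt (T a)

lemma continuous_outEnt (T : α → β → ℝ) : Continuous fun p => massEnt (outLaw T p) := by
  unfold massEnt outLaw
  fun_prop

lemma continuous_chanMI (T : α → β → ℝ) : Continuous (chanMI T) := by
  unfold chanMI
  have := continuous_outEnt T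
  fun_prop

lemma outLaw_nonneg {β : Type*} {T : α → β → ℝ} (hT : ∀ a b, 0 ≤ T a b) {p : α → ℝ} (hp : ∀ a, 0 ≤ p a) (b : β) :
    0 ≤ outLaw T p b := Finset.sum_nonneg fun a _ => mul_nonneg (hp a) (hT a b)

lemma concaveOn_outEnt {T : α → β → ℝ} (hT : ∀ a b, 0 ≤ T a b) :
    ConcaveOn ℝ (stdSimplex ℝ α) fun p => massEnt (outLaw T p) := by
  refine ⟨convex_stdSimplex ℝ α, fun p hp q hq a b ha hb hab => ?_⟩
  simp only [massEnt, smul_eq_mul, Finset.mul_sum, ← Finset.sum_add_distrib]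
  refine Finset.sum_le_sum fun y _ => ?_
  have h := concaveOn_negMulLog.2 (outLaw_nonneg hT hp.1 y) (outLaw_nonneg hT hq.1 y) ha hb hab
  simp only [smul_eq_mul] at h
  refine h.trans_eq ?_
  congr 1
  simp only [outLaw, Pi.add_apply, Pi.smul_apply, smul_eq_mul, Finset.mul_sum, add_mul,
    Finset.sum_add_distrib, mul_assoc]

/-- The conditional output entropy is linear in the input law, so concavity is inherited from the
output entropy. -/
lemma concaveOn_chanMI {T : α → β → ℝ} (hT : ∀ a b, 0 ≤ T a b) :
    ConcaveOn ℝ (stdSimplex ℝ α) (chanMI T) := by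
  refine (concaveOn_outEnt hT).sub ⟨convex_stdSimplex ℝ α, fun p _ q _ a b _ _ _ => le_of_eq ?_⟩
  simp only [Pi.add_apply, Pi.smul_apply, smul_eq_mul, add_mul, Finset.sum_add_distrib,
    Finset.mul_sum, mul_assoc]

/-- A degraded version of the output adds nothing to the mutual information. -/
lemma chanMI_degraded (T : α → β → ℝ) {k : β → γ → ℝ} (hk : ∀ b, ∑ c, k b c = 1) (p : α → ℝ) :
    chanMI (fun a (y : β × γ) => T a y.1 * k y.1 y.2) p = chanMI T p := by
  have key : ∀ r : β → ℝ, massEnt (fun y : β × γ => r y.1 * k y.1 y.2) =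
      massEnt r + ∑ b, r b * massEnt (k b) := by
    intro r
    simp only [massEnt, Fintype.sum_prod_type, negMulLog_mul, ← Finset.sum_add_distrib]
    refine Finset.sum_congr rfl fun b _ => ?_
    rw [Finset.sum_add_distrib, ← Finset.sum_mul, hk, one_mul, Finset.mul_sum]
  have h1 : outLaw (fun a (y : β × γ) => T a y.1 * k y.1 y.2) p =
      fun y : β × γ => outLaw T p y.1 * k y.1 y.2 := by
    funext y
    simp only [outLaw, Finset.sum_mul, mul_assoc]
  rw [chanMI, chanMI, h1, key]
  simp only [key, mul_add, Finset.sum_add_distrib]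
  have h2 : ∑ a, p a * ∑ b, T a b * massEnt (k b) = ∑ b, outLaw T p b * massEnt (k b) := by
    simp only [outLaw, Finset.mul_sum, Finset.sum_mul]
    rw [Finset.sum_comm]
    simp only [mul_assoc]
  rw [h2]
  ring

end Channel

/-! ### The convex sets traced out by auxiliary variables U and V. -/

section Hulls

variable {α : Type*} [Fintype α]

/-- The points `(p, E f(p_V), E h(p_V))` for random laws `p_V` of mean `p`. -/
def innerHull (f h : (α → ℝ) → ℝ) : Set ((α → ℝ) × ℝ × ℝ) :=
  convexHull ℝ ((fun p => (p, f p, h p)) '' stdSimplex ℝ α)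

/-- The points `(p, E f(p_U), E g(p_U), E f(p_{UV}), E h(p_{UV}))` for random laws `p_{UV}` of
mean `p`, where `p_U` is the mean of `p_{UV}` given `U`. -/
def outerHull (f g h : (α → ℝ) → ℝ) : Set ((α → ℝ) × ℝ × ℝ × ℝ × ℝ) :=
  convexHull ℝ ((fun z : (α → ℝ) × ℝ × ℝ => (z.1, f z.1, g z.1, z.2)) '' innerHull f h)

variable {f g h : (α → ℝ) → ℝ}

lemma isCompact_outerHull (hf : Continuous f) (hg : Continuous g) (hh : Continuous h) :
    IsCompact (outerHull f g h) := by
  have h1 : IsCompact (innerHull f h) :=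
    isCompact_convexHull ((isCompact_stdSimplex ℝ α).image (by fun_prop))
  exact isCompact_convexHull (h1.image (by fun_prop))

lemma convex_outerHull : Convex ℝ (outerHull f g h) := convex_convexHull ℝ _

lemma fst_mem_of_mem_innerHull {z : (α → ℝ) × ℝ × ℝ} (hz : z ∈ innerHull f h) :
    z.1 ∈ stdSimplex ℝ α := by
  have h1 : innerHull f h ⊆ LinearMap.fst ℝ (α → ℝ) (ℝ × ℝ) ⁻¹' stdSimplex ℝ α := by
    refine convexHull_min ?_ ((convex_stdSimplex ℝ α).linear_preimage _)
    rintro _ ⟨p, hp, rfl⟩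
    exact hp
  exact h1 hz

lemma fst_mem_of_mem_outerHull {z : (α → ℝ) × ℝ × ℝ × ℝ × ℝ} (hz : z ∈ outerHull f g h) :
    z.1 ∈ stdSimplex ℝ α := by
  have h1 : outerHull f g h ⊆ LinearMap.fst ℝ (α → ℝ) (ℝ × ℝ × ℝ × ℝ) ⁻¹' stdSimplex ℝ α := by
    refine convexHull_min ?_ ((convex_stdSimplex ℝ α).linear_preimage _)
    rintro _ ⟨p, hp, rfl⟩
    exact fst_mem_of_mem_innerHull hp
  exact h1 hz

lemma outerHull_nonempty [Nonempty α] : (outerHull f g h).Nonempty := by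
  classical
  obtain ⟨a⟩ := ‹Nonempty α›
  exact convexHull_nonempty_iff.2 (Set.Nonempty.image _ (convexHull_nonempty_iff.2
    (Set.Nonempty.image _ ⟨_, single_mem_stdSimplex ℝ a⟩)))

/-- The conditional law of `X` given `C = c`. -/
def condLaw {Ω γ : Type*} [Fintype Ω] (P : Ω → ℝ) (X : Ω → α) (C : Ω → γ) (c : γ) : α → ℝ :=
  fun a => prob P (pair X C) (a, c) / prob P C c

lemma condLaw_mem {Ω γ : Type*} [Fintype Ω] [Fintype γ] {P : Ω → ℝ} (hP : ∀ ω, 0 ≤ P ω)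
    (X : Ω → α) (C : Ω → γ) {c : γ} (hc : prob P C c ≠ 0) :
    condLaw P X C c ∈ stdSimplex ℝ α := by
  refine ⟨fun a => div_nonneg (prob_nonneg hP _ _) (prob_nonneg hP _ _), ?_⟩
  simp only [condLaw]
  rw [← Finset.sum_div, sum_prob_pair_left, div_self hc]

lemma prod_ext_sum {ι E F : Type*} [AddCommMonoid E] [AddCommMonoid F] (t : Finset ι) (x : ι → E)
    (y : ι → F) : ∑ i ∈ t, (x i, y i) = (∑ i ∈ t, x i, ∑ i ∈ t, y i) :=
  Prod.ext (by simp [Prod.fst_sum]) (by simp [Prod.snd_sum])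

/-- Random variables `U`, `V`, `X` give a point of the hull. -/
lemma mem_outerHull_of_prob {Ω μ ν : Type*} [Fintype Ω] [Fintype μ] [Fintype ν] {P : Ω → ℝ}
    (hP : P ∈ stdSimplex ℝ Ω) (X : Ω → α) (U : Ω → μ) (V : Ω → ν) :
    (prob P X, ∑ u, prob P U u * f (condLaw P X U u), ∑ u, prob P U u * g (condLaw P X U u),
      ∑ c, prob P (pair U V) c * f (condLaw P X (pair U V) c),
      ∑ c, prob P (pair U V) c * h (condLaw P X (pair U V) c)) ∈ outerHull f g h := by
  set Q := prob P (pair U V)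
  have hU : ∀ u, ∑ v, Q (u, v) = prob P U u := fun u => sum_prob_pair_right P U V u
  have hQ0 : ∀ u v, prob P U u = 0 → Q (u, v) = 0 := fun u v h =>
    le_antisymm ((prob_pair_le_left hP.1 U V u v).trans_eq h) (prob_nonneg hP.1 _ _)
  have hXUV : ∀ u a, ∑ v, prob P (pair X (pair U V)) (a, u, v) = prob P (pair X U) (a, u) := by
    intro u a
    rw [← sum_prob_pair_right P (pair X U) V (a, u)]
    classical
    simp only [prob_eq_sum, pair, Prod.mk.injEq, and_assoc]
  -- The law of X given U = u is the mean of its laws given U = u and V; this makes the inner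
  -- combination have the right first coordinate.
  have hmean : ∀ u a, ∑ v, Q (u, v) * condLaw P X (pair U V) (u, v) a =
      prob P (pair X U) (a, u) := by
    intro u a
    rw [← hXUV]
    refine Finset.sum_congr rfl fun v _ => ?_
    rw [condLaw]
    by_cases h0 : Q (u, v) = 0
    · rw [h0, zero_mul]
      exact (le_antisymm ((prob_pair_le hP.1 X (pair U V) a (u, v)).trans_eq h0)
        (prob_nonneg hP.1 _ _)).symm
    · rw [mul_div_cancel₀ _ h0]
  have hinner : ∀ u, prob P U u ≠ 0 →
      (condLaw P X U u, ∑ v, Q (u, v) / prob P U u * f (condLaw P X (pair U V) (u, v)),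
        ∑ v, Q (u, v) / prob P U u * h (condLaw P X (pair U V) (u, v))) ∈ innerHull f h := by
    intro u hu
    have := sum_smul_mem_of_ne_zero (convex_convexHull ℝ ((fun p => (p, f p, h p)) '' stdSimplex ℝ α))
      (w := fun v => Q (u, v) / prob P U u)
      (z := fun v => (condLaw P X (pair U V) (u, v), f (condLaw P X (pair U V) (u, v)),
        h (condLaw P X (pair U V) (u, v))))
      (fun v => div_nonneg (prob_nonneg hP.1 _ _) (prob_nonneg hP.1 _ _))
      (by rw [← Finset.sum_div, hU, div_self hu])
      (fun v hv => subset_convexHull ℝ _ ⟨_, condLaw_mem hP.1 X (pair U V)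
        (fun h0 => hv (by simp [Q, h0])), rfl⟩)
    simp only [Prod.smul_mk, prod_ext_sum, smul_eq_mul] at this
    rw [innerHull]
    convert this using 2
    funext a
    rw [Finset.sum_apply]
    simp only [Pi.smul_apply, smul_eq_mul, div_mul_eq_mul_div]
    rw [← Finset.sum_div, hmean, condLaw]
  have := sum_smul_mem_of_ne_zero (convex_outerHull (f := f) (g := g) (h := h))
    (w := prob P U) (z := fun u => (condLaw P X U u, f (condLaw P X U u), g (condLaw P X U u),
      ∑ v, Q (u, v) / prob P U u * f (condLaw P X (pair U V) (u, v)),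
        ∑ v, Q (u, v) / prob P U u * h (condLaw P X (pair U V) (u, v))))
    (prob_nonneg hP.1 U) ((sum_prob P U).trans hP.2)
    (fun u hu => subset_convexHull ℝ _ ⟨_, hinner u hu, rfl⟩)
  simp only [Prod.smul_mk, prod_ext_sum, smul_eq_mul] at this
  have hw : ∀ (F : μ × ν → ℝ) (u : μ), prob P U u * ∑ v, Q (u, v) / prob P U u * F (u, v) =
      ∑ v, Q (u, v) * F (u, v) := by
    intro F u
    rw [Finset.mul_sum]
    refine Finset.sum_congr rfl fun v _ => ?_
    by_cases h0 : prob P U u = 0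
    · simp [h0, hQ0 u v h0]
    · field_simp
  rw [Finset.sum_congr rfl fun u _ => hw (fun c => f (condLaw P X (pair U V) c)) u,
    Finset.sum_congr rfl fun u _ => hw (fun c => h (condLaw P X (pair U V) c)) u,
    ← Fintype.sum_prod_type (fun c => Q c * f (condLaw P X (pair U V) c)),
    ← Fintype.sum_prod_type (fun c => Q c * h (condLaw P X (pair U V) c))] at this
  convert this using 2
  funext a
  rw [Finset.sum_apply, ← sum_prob_pair_right P X U a]
  refine Finset.sum_congr rfl fun u _ => ?_
  simp only [Pi.smul_apply, smul_eq_mul, condLaw]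
  by_cases h0 : prob P U u = 0
  · rw [h0, zero_mul]
    exact le_antisymm ((prob_pair_le hP.1 X U a u).trans_eq h0) (prob_nonneg hP.1 _ _)
  · rw [mul_div_cancel₀ _ h0]

/-- Points of finitely many hulls come from conditional laws on common finite alphabets. -/
lemma exists_laws_of_mem_outerHull {S : Type*} [Fintype S] {f g h : S → (α → ℝ) → ℝ}
    {z : S → (α → ℝ) × ℝ × ℝ × ℝ × ℝ} (hz : ∀ s, z s ∈ outerHull (f s) (g s) (h s)) :
    ∃ (kU kV : ℕ) (wU : S → Fin kU → ℝ) (wV : S → Fin kU → Fin kV → ℝ)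
      (p : S → Fin kU → Fin kV → α → ℝ),
      (∀ s, wU s ∈ stdSimplex ℝ (Fin kU)) ∧ (∀ s u, wV s u ∈ stdSimplex ℝ (Fin kV)) ∧
      (∀ s u v, p s u v ∈ stdSimplex ℝ α) ∧ ∀ s, z s =
        (∑ u, wU s u • ∑ v, wV s u v • p s u v,
         ∑ u, wU s u * f s (∑ v, wV s u v • p s u v),
         ∑ u, wU s u * g s (∑ v, wV s u v • p s u v),
         ∑ u, wU s u * ∑ v, wV s u v * f s (p s u v),
         ∑ u, wU s u * ∑ v, wV s u v * h s (p s u v)) := by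
  obtain ⟨kU, wU, y, hwU, hy, hz⟩ := exists_fin_of_mem_convexHull hz
  choose t ht hy using hy
  obtain ⟨kV, wV, x, hwV, hx, ht⟩ := exists_fin_of_mem_convexHull (ι := S × Fin kU)
    (s := fun i => (fun p => (p, f i.1 p, h i.1 p)) '' stdSimplex ℝ α) (x := fun i => t i.1 i.2)
    fun i => ht i.1 i.2
  choose p hp hx using hx
  refine ⟨kU, kV, wU, fun s u => wV (s, u), fun s u => p (s, u), hwU, fun s u => hwV (s, u),
    fun s u => hp (s, u), fun s => ?_⟩
  have h1 : ∀ u, t s u = (∑ v, wV (s, u) v • p (s, u) v, ∑ v, wV (s, u) v * f s (p (s, u) v),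
      ∑ v, wV (s, u) v * h s (p (s, u) v)) := by
    intro u
    rw [← ht (s, u)]
    simp only [← hx, Prod.smul_mk, prod_ext_sum, smul_eq_mul]
  rw [← hz s]
  simp only [← hy, h1, Prod.smul_mk, prod_ext_sum, smul_eq_mul]

end Hulls

/-! ### Further facts on conditional entropy. -/

section EntMore

variable {Ω α β γ : Type*} [Fintype Ω] [Fintype α] [Fintype β] [Fintype γ]

/-- Conditioning on more reduces entropy. -/
lemma ent_cond_antitone {P : Ω → ℝ} (hP : ∀ ω, 0 ≤ P ω) (A : Ω → α) {C : Ω → γ} {D : Ω → β}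
    (h : ∀ ω ω', D ω = D ω' → C ω = C ω') :
    Ent P (pair A D) - Ent P D ≤ Ent P (pair A C) - Ent P C := by
  have h1 := ent_submodular hP A D C
  have h2 : Ent P (pair A (pair D C)) = Ent P (pair A D) := ent_congr P fun ω ω' => by
    simp only [pair, Prod.mk.injEq]; exact ⟨fun h => ⟨h.1, h.2.1⟩, fun h' => ⟨h'.1, h'.2, h _ _ h'.2⟩⟩
  have h3 : Ent P (pair D C) = Ent P D := ent_congr P fun ω ω' => by
    simp only [pair, Prod.mk.injEq]; exact ⟨fun h => h.1, fun h' => ⟨h', h _ _ h'⟩⟩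
  rwa [h2, h3] at h1

lemma ent_of_uniform [Nonempty α] (P : Ω → ℝ) (A : Ω → α)
    (h : ∀ a, prob P A a = 1 / Fintype.card α) : Ent P A = log (Fintype.card α) := by
  have hc : (Fintype.card α : ℝ) ≠ 0 := by exact_mod_cast Fintype.card_ne_zero
  simp only [Ent, massEnt, h, Finset.sum_const, Finset.card_univ, nsmul_eq_mul, negMulLog, one_div,
    log_inv]
  field_simp

/-- A quantity linear in the law of `X` is unchanged on average by conditioning. It makes the noise
term H(output | input) the same for every choice of auxiliary variables. -/
lemma sum_prob_mul_sum_condLaw {P : Ω → ℝ} (hP : ∀ ω, 0 ≤ P ω) (X : Ω → α) (C : Ω → γ)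
    (m : α → ℝ) :
    ∑ c, prob P C c * ∑ a, condLaw P X C c a * m a = ∑ a, prob P X a * m a := by
  simp only [Finset.mul_sum]
  rw [Finset.sum_comm]
  refine Finset.sum_congr rfl fun a _ => ?_
  rw [← sum_prob_pair_right P X C a, Finset.sum_mul]
  refine Finset.sum_congr rfl fun c _ => ?_
  rw [← mul_assoc, condLaw]
  by_cases h0 : prob P C c = 0
  · rw [h0, zero_mul, zero_mul, le_antisymm ((prob_pair_le hP X C a c).trans_eq h0)
      (prob_nonneg hP _ _), zero_mul]
  · rw [mul_div_cancel₀ _ h0]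

end EntMore

/-- Under a product law, coordinate `i` is independent of anything that does not look at it. -/
lemma sum_prod_mul_coord {ι Z : Type*} [Fintype ι] [DecidableEq ι] [Fintype Z] (t : ι → Z → ℝ)
    (i : ι) (ht : ∑ z, t i z = 1) (φ : (ι → Z) → ℝ)
    (hφ : ∀ z y, φ (Function.update z i y) = φ z) (ψ : Z → ℝ) :
    ∑ z : ι → Z, (∏ j, t j (z j)) * (φ z * ψ (z i)) =
      (∑ z : ι → Z, (∏ j, t j (z j)) * φ z) * ∑ y, t i y * ψ y := by
  have hne : Nonempty Z := by
    by_contra h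
    rw [not_nonempty_iff] at h
    simp at ht
  obtain ⟨y₀⟩ := hne
  -- `R` weighs the remaining coordinates; `y₀` merely fills slot `i`, which `φ` ignores.
  set R : ({j // j ≠ i} → Z) → ℝ := fun r => (∏ j : {j // j ≠ i}, t j (r j)) *
    φ ((Equiv.funSplitAt i Z).symm (y₀, r))
  have key : ∀ ψ : Z → ℝ, ∑ z : ι → Z, (∏ j, t j (z j)) * (φ z * ψ (z i)) =
      (∑ r, R r) * ∑ y, t i y * ψ y := by
    intro ψ
    rw [← (Equiv.funSplitAt i Z).symm.sum_comp, Fintype.sum_prod_type, Finset.sum_comm,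
      Finset.sum_mul_sum]
    refine Finset.sum_congr rfl fun r _ => Finset.sum_congr rfl fun y _ => ?_
    have h1 : φ ((Equiv.funSplitAt i Z).symm (y, r)) =
        φ ((Equiv.funSplitAt i Z).symm (y₀, r)) := by
      rw [← hφ _ y₀]
      congr 1
      funext j
      by_cases hj : j = i
      · subst hj; simp [Equiv.funSplitAt]
      · simp [Equiv.funSplitAt, hj]
    have h2 : (∏ j, t j ((Equiv.funSplitAt i Z).symm (y, r) j)) =
        t i y * ∏ j : {j // j ≠ i}, t j (r j) := by
      rw [Fintype.prod_eq_mul_prod_subtype_ne _ i]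
      congr 1
      · simp [Equiv.funSplitAt]
      · refine Finset.prod_congr rfl fun j _ => ?_
        simp [Equiv.funSplitAt, j.2]
    have h3 : (Equiv.funSplitAt i Z).symm (y, r) i = y := by simp [Equiv.funSplitAt]
    rw [h1, h2, h3]
    ring
  have h1 := key fun _ => 1
  simp only [mul_one, ht] at h1
  rw [key, h1]

/-! ### Messages and outputs of a block; the past and the future of an output as `Option`-valued
sequences of fixed type. -/

section Block

variable {X Z α : Type*} {n : ℕ} {μ ν : Type*}

/-- The joint law of the uniform messages and the outputs of the channels `T i`. -/
def blockLaw [Fintype μ] [Fintype ν] (T : Fin n → X → Z → ℝ) (x : μ → ν → Fin n → X) : (μ × ν) × (Fin n → Z) → ℝ :=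
  fun ω => 1 / ((Fintype.card μ : ℝ) * Fintype.card ν) * ∏ i, T i (x ω.1.1 ω.1.2 i) (ω.2 i)

/-- The outputs before time `k`. -/
def before (a : Z → α) (k : ℕ) (ω : (μ × ν) × (Fin n → Z)) : Fin n → Option α :=
  fun j => if j.1 < k then some (a (ω.2 j)) else none

/-- The outputs from time `k` on. -/
def after (a : Z → α) (k : ℕ) (ω : (μ × ν) × (Fin n → Z)) : Fin n → Option α :=
  fun j => if k ≤ j.1 then some (a (ω.2 j)) else none

/-- The output at time `i`. -/
def outputAt (a : Z → α) (i : Fin n) (ω : (μ × ν) × (Fin n → Z)) : α := a (ω.2 i)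

lemma before_eq_iff (a : Z → α) (k : ℕ) (ω ω' : (μ × ν) × (Fin n → Z)) :
    before a k ω = before a k ω' ↔ ∀ j : Fin n, j.1 < k → a (ω.2 j) = a (ω'.2 j) := by
  simp only [before, funext_iff]
  refine forall_congr' fun j => ?_
  by_cases h : j.1 < k <;> simp [h]

lemma after_eq_iff (a : Z → α) (k : ℕ) (ω ω' : (μ × ν) × (Fin n → Z)) :
    after a k ω = after a k ω' ↔ ∀ j : Fin n, k ≤ j.1 → a (ω.2 j) = a (ω'.2 j) := by
  simp only [after, funext_iff]
  refine forall_congr' fun j => ?_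
  by_cases h : k ≤ j.1 <;> simp [h]

lemma before_succ_eq_iff (a : Z → α) (i : Fin n) (ω ω' : (μ × ν) × (Fin n → Z)) :
    before a (i + 1) ω = before a (i + 1) ω' ↔
      outputAt a i ω = outputAt a i ω' ∧ before a i ω = before a i ω' := by
  simp only [before_eq_iff, outputAt]
  constructor
  · exact fun h => ⟨h i (Nat.lt_succ_self _), fun j hj => h j (Nat.lt_succ_of_lt hj)⟩
  · rintro ⟨h1, h2⟩ j hj
    rcases (Nat.lt_succ_iff.1 hj).eq_or_lt with h | h
    · rwa [Fin.ext h]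
    · exact h2 j h

lemma after_eq_iff_succ (a : Z → α) (i : Fin n) (ω ω' : (μ × ν) × (Fin n → Z)) :
    after a i ω = after a i ω' ↔
      outputAt a i ω = outputAt a i ω' ∧ after a (i + 1) ω = after a (i + 1) ω' := by
  simp only [after_eq_iff, outputAt]
  constructor
  · exact fun h => ⟨h i le_rfl, fun j hj => h j (Nat.le_of_succ_le hj)⟩
  · rintro ⟨h1, h2⟩ j hj
    rcases hj.eq_or_lt with h | h
    · rwa [← Fin.ext h]
    · exact h2 j h

variable [Fintype Z] [Fintype μ] [Fintype ν] {T : Fin n → X → Z → ℝ} {x : μ → ν → Fin n → X}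

lemma sum_blockLaw_mul (T : Fin n → X → Z → ℝ) (x : μ → ν → Fin n → X)
    (φ : (μ × ν) × (Fin n → Z) → ℝ) :
    ∑ ω, blockLaw T x ω * φ ω = ∑ m : μ × ν, 1 / ((Fintype.card μ : ℝ) * Fintype.card ν) *
      ∑ z : Fin n → Z, (∏ i, T i (x m.1 m.2 i) (z i)) * φ (m, z) := by
  rw [Fintype.sum_prod_type]
  simp only [blockLaw, Finset.mul_sum, mul_assoc]

lemma sum_prod_eq_one (hT : ∀ i a, T i a ∈ stdSimplex ℝ Z) (m : μ × ν) :
    ∑ z : Fin n → Z, ∏ i, T i (x m.1 m.2 i) (z i) = 1 := by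
  have h := Finset.prod_univ_sum (fun _ => Finset.univ) fun i z => T i (x m.1 m.2 i) z
  simp only [Fintype.piFinset_univ, (hT _ _).2, Finset.prod_const_one] at h
  exact h.symm

lemma blockLaw_mem [Nonempty μ] [Nonempty ν] (hT : ∀ i a, T i a ∈ stdSimplex ℝ Z) :
    blockLaw T x ∈ stdSimplex ℝ ((μ × ν) × (Fin n → Z)) := by
  refine ⟨fun ω => mul_nonneg (by positivity) (Finset.prod_nonneg fun i _ => (hT _ _).1 _), ?_⟩
  have h := sum_blockLaw_mul T x fun _ => 1
  simp only [mul_one, sum_prod_eq_one hT] at h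
  rw [h]
  have h1 : (Fintype.card μ : ℝ) ≠ 0 := by exact_mod_cast Fintype.card_ne_zero
  have h2 : (Fintype.card ν : ℝ) ≠ 0 := by exact_mod_cast Fintype.card_ne_zero
  simp only [Finset.sum_const, Finset.card_univ, Fintype.card_prod, nsmul_eq_mul, Nat.cast_mul]
  field_simp

/-- Given everything but the output at time `i`, that output has law `T i x_i`. -/
lemma sum_blockLaw_mul_coord (hT : ∀ i a, T i a ∈ stdSimplex ℝ Z) (i : Fin n)
    (φ : (μ × ν) × (Fin n → Z) → ℝ) (hφ : ∀ m z y, φ (m, Function.update z i y) = φ (m, z))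
    (ψ : Z → ℝ) :
    ∑ ω, blockLaw T x ω * (φ ω * ψ (ω.2 i)) =
      ∑ ω, blockLaw T x ω * (φ ω * ∑ z, T i (x ω.1.1 ω.1.2 i) z * ψ z) := by
  rw [sum_blockLaw_mul, sum_blockLaw_mul]
  refine Finset.sum_congr rfl fun m _ => ?_
  congr 1
  have h := sum_prod_mul_coord (fun j => T j (x m.1 m.2 j)) i (hT _ _).2 (fun z => φ (m, z))
    (hφ m) ψ
  simp only at h ⊢
  rw [h, Finset.sum_mul]
  simp only [mul_assoc]

end Block

/-! ### Single-letter entropies, chain rules and Csiszár's identity. -/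

section Block

variable {X Z α β γ : Type*} [Fintype X] [Fintype Z] [Fintype α] [Fintype β] [Fintype γ] {n : ℕ}
  {μ ν : Type*} [Fintype μ] [Fintype ν] {T : Fin n → X → Z → ℝ} {x : μ → ν → Fin n → X}

/-- The channel input at time `i`. -/
def inputAt (x : μ → ν → Fin n → X) (i : Fin n) (ω : (μ × ν) × (Fin n → Z)) : X :=
  x ω.1.1 ω.1.2 i

lemma before_update (a : Z → α) (i : Fin n) (m : μ × ν) (z : Fin n → Z) (y : Z) :
    before a i (m, Function.update z i y) = before a i (m, z) := by
  rw [before_eq_iff]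
  intro j hj
  have : j ≠ i := fun h => by simp [h] at hj
  simp [this]

lemma after_update (a : Z → α) (i : Fin n) (m : μ × ν) (z : Fin n → Z) (y : Z) :
    after a (i + 1) (m, Function.update z i y) = after a (i + 1) (m, z) := by
  rw [after_eq_iff]
  intro j hj
  have : j ≠ i := fun h => by simp [h] at hj
  simp [this]

lemma prob_pair_outputAt [DecidableEq γ] (hT : ∀ i a, T i a ∈ stdSimplex ℝ Z) (a : Z → α)
    (i : Fin n) {F : (μ × ν) × (Fin n → Z) → γ}
    (hF : ∀ m z y, F (m, Function.update z i y) = F (m, z)) (y : α) (f : γ) :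
    prob (blockLaw T x) (pair (outputAt a i) F) (y, f) =
      ∑ ω, blockLaw T x ω * ((if F ω = f then 1 else 0) * prob (T i (inputAt x i ω)) a y) := by
  classical
  have h := sum_blockLaw_mul_coord (x := x) hT i (fun ω => if F ω = f then (1 : ℝ) else 0)
    (fun m z y => by simp only [hF]) fun z => if a z = y then 1 else 0
  simp only [mul_ite, mul_one, mul_zero] at h
  simp only [prob_eq_sum, pair, Prod.mk.injEq, outputAt, inputAt, ite_and]
  simpa using h

/-- Without feedback the current input depends on the messages alone. Hence messages and outputs at
other times influence the output at time `i` only through that input. -/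
lemma prob_markov (hT : ∀ i a, T i a ∈ stdSimplex ℝ Z) (a : Z → α)
    (i : Fin n) {F : (μ × ν) × (Fin n → Z) → γ}
    (hF : ∀ m z y, F (m, Function.update z i y) = F (m, z)) (y : α) (t : X) (f : γ) :
    prob (blockLaw T x) (pair (outputAt a i) (pair (inputAt x i) F)) (y, t, f) =
      prob (blockLaw T x) (pair (inputAt x i) F) (t, f) * prob (T i t) a y := by
  classical
  rw [prob_pair_outputAt hT a i (F := pair (inputAt x i) F)
    (fun m z y => by simp only [pair, hF, inputAt]), prob_eq_sum _ (pair (inputAt x i) F),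
    Finset.sum_mul]
  refine Finset.sum_congr rfl fun ω _ => ?_
  by_cases h : pair (inputAt x i) F ω = (t, f)
  · have h1 : inputAt x i ω = t := (Prod.mk.inj h).1
    simp [h, h1]
  · simp [h]

/-- The channel from the input to the function `a` of the output. -/
def mapChan (T : X → Z → ℝ) (a : Z → α) : X → α → ℝ := fun t => prob (T t) a

lemma ent_outputAt_cond [Nonempty μ] [Nonempty ν] (hT : ∀ i a, T i a ∈ stdSimplex ℝ Z) (a : Z → α)
    (i : Fin n) {F : (μ × ν) × (Fin n → Z) → γ}
    (hF : ∀ m z y, F (m, Function.update z i y) = F (m, z)) :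
    Ent (blockLaw T x) (pair (outputAt a i) F) - Ent (blockLaw T x) F =
      ∑ f, prob (blockLaw T x) F f *
        massEnt (outLaw (mapChan (T i) a) (condLaw (blockLaw T x) (inputAt x i) F f)) :=
  ent_pair_of_markov (blockLaw_mem hT).1 (inputAt x i) (outputAt a i) F (mapChan (T i) a)
    fun y t f => prob_markov hT a i hF y t f

lemma ent_outputAt (hT : ∀ i a, T i a ∈ stdSimplex ℝ Z) (a : Z → α) (i : Fin n) :
    Ent (blockLaw T x) (outputAt a i) =
      massEnt (outLaw (mapChan (T i) a) (prob (blockLaw T x) (inputAt x i))) := by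
  classical
  rw [Ent]
  congr 1
  funext y
  rw [← sum_prob_pair_right (blockLaw T x) (outputAt a i) (fun _ => ()) y]
  simp only [Finset.univ_unique, Finset.sum_singleton]
  rw [prob_pair_outputAt hT a i (fun _ _ _ => rfl), outLaw,
    sum_prob_mul (blockLaw T x) (inputAt x i) fun t => mapChan (T i) a t y]
  simp [mapChan]

/-- Both messages determine the input, so only channel noise remains and the past outputs are
irrelevant. -/
lemma ent_outputAt_messages (hT : ∀ i a, T i a ∈ stdSimplex ℝ Z) (a : Z → α) (i : Fin n) :
    Ent (blockLaw T x) (pair (outputAt a i) (pair Prod.fst (before a i))) -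
        Ent (blockLaw T x) (pair Prod.fst (before a i)) =
      ∑ t, prob (blockLaw T x) (inputAt x i) t * massEnt (mapChan (T i) a t) := by
  classical
  rw [ent_pair_of_channel (blockLaw T x) (pair Prod.fst (before a i)) (outputAt a i)
    (fun f => mapChan (T i) a (x f.1.1 f.1.2 i))]
  · rw [sum_prob_mul (blockLaw T x) (pair Prod.fst (before a i)) fun f =>
      massEnt (mapChan (T i) a (x f.1.1 f.1.2 i)),
      sum_prob_mul (blockLaw T x) (inputAt x i) fun t => massEnt (mapChan (T i) a t)]
    rfl
  · exact fun f => (prob_mem_stdSimplex (hT _ _) a).2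
  · intro f y
    rw [prob_pair_outputAt hT a i (fun m z y => by simp only [pair, before_update]),
      prob_eq_sum _ (pair Prod.fst (before a i)), Finset.sum_mul]
    refine Finset.sum_congr rfl fun ω _ => ?_
    by_cases h : pair Prod.fst (before a i) ω = f
    · have h1 : inputAt x i ω = x f.1.1 f.1.2 i := by rw [← h]; rfl
      simp [h, h1, mapChan]
    · simp [h]

/-- Chain rule, forwards in time. -/
lemma ent_before_chain (P : (μ × ν) × (Fin n → Z) → ℝ) (a : Z → α)
    (W : (μ × ν) × (Fin n → Z) → γ) :
    Ent P (pair W (before a n)) - Ent P W = ∑ i : Fin n,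
      (Ent P (pair (outputAt a i) (pair W (before a i))) - Ent P (pair W (before a i))) := by
  have h1 : ∀ i : Fin n, Ent P (pair (outputAt a i) (pair W (before a i))) =
      Ent P (pair W (before a (i + 1))) := fun i => ent_congr P fun ω ω' => by
    simp only [pair, Prod.mk.injEq, before_succ_eq_iff]; tauto
  have h2 : Ent P (pair W (before a 0)) = Ent P W := ent_congr P fun ω ω' => by
    simp [pair, before_eq_iff]
  simp only [h1]
  rw [Fin.sum_univ_eq_sum_range fun i =>
    Ent P (pair W (before a (i + 1))) - Ent P (pair W (before a i)), Finset.sum_range_sub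
    (fun i => Ent P (pair W (before a i))), h2]

/-- Chain rule, backwards in time. -/
lemma ent_after_chain (P : (μ × ν) × (Fin n → Z) → ℝ) (a : Z → α)
    (W : (μ × ν) × (Fin n → Z) → γ) :
    Ent P (pair W (after a 0)) - Ent P W = ∑ i : Fin n,
      (Ent P (pair (outputAt a i) (pair W (after a (i + 1)))) -
        Ent P (pair W (after a (i + 1)))) := by
  have h1 : ∀ i : Fin n, Ent P (pair (outputAt a i) (pair W (after a (i + 1)))) =
      Ent P (pair W (after a i)) := fun i => ent_congr P fun ω ω' => by
    simp only [pair, Prod.mk.injEq, after_eq_iff_succ a i]; tauto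
  have h2 : Ent P (pair W (after a n)) = Ent P W := ent_congr P fun ω ω' => by
    simp [pair, after_eq_iff]
  simp only [h1]
  rw [Fin.sum_univ_eq_sum_range fun i =>
    Ent P (pair W (after a i)) - Ent P (pair W (after a (i + 1))), Finset.sum_range_sub'
    (fun i => Ent P (pair W (after a i))), h2]

/-- The Csiszár sum identity. -/
lemma csiszar_sum (P : (μ × ν) × (Fin n → Z) → ℝ) (a : Z → α) (c : Z → β)
    (W : (μ × ν) × (Fin n → Z) → γ) :
    Ent P (pair W (before a n)) - Ent P (pair W (after c 0)) = ∑ i : Fin n,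
      ((Ent P (pair (outputAt a i) (pair (pair W (before a i)) (after c (i + 1)))) -
        Ent P (pair (pair W (before a i)) (after c (i + 1)))) -
      (Ent P (pair (outputAt c i) (pair (pair W (before a i)) (after c (i + 1)))) -
        Ent P (pair (pair W (before a i)) (after c (i + 1))))) := by
  have h1 : ∀ i : Fin n, Ent P (pair (outputAt a i) (pair (pair W (before a i)) (after c (i + 1)))) =
      Ent P (pair (pair W (before a (i + 1))) (after c (i + 1))) :=
    fun i => ent_congr P fun ω ω' => by
      simp only [pair, Prod.mk.injEq, before_succ_eq_iff]; tauto
  have h2 : ∀ i : Fin n, Ent P (pair (outputAt c i) (pair (pair W (before a i)) (after c (i + 1)))) =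
      Ent P (pair (pair W (before a i)) (after c i)) :=
    fun i => ent_congr P fun ω ω' => by
      simp only [pair, Prod.mk.injEq, after_eq_iff_succ c i]; tauto
  have h3 : Ent P (pair W (before a n)) = Ent P (pair (pair W (before a n)) (after c n)) :=
    ent_congr P fun ω ω' => by
      simp [pair, after_eq_iff]
  have h4 : Ent P (pair W (after c 0)) = Ent P (pair (pair W (before a 0)) (after c 0)) :=
    ent_congr P fun ω ω' => by simp [pair, before_eq_iff]
  -- The conditioning terms cancel, and what is left telescopes: each step adds one output to the
  -- past of `a` and removes one from the future of `c`.
  simp only [h1, h2, sub_sub_sub_cancel_right]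
  rw [Fin.sum_univ_eq_sum_range fun i =>
    Ent P (pair (pair W (before a (i + 1))) (after c (i + 1))) -
      Ent P (pair (pair W (before a i)) (after c i)), Finset.sum_range_sub
    (fun i => Ent P (pair (pair W (before a i)) (after c i))), h3, h4]

end Block

/-! ### The converse for time-varying memoryless channels. -/

section Block

variable {X Z α β γ : Type*} [Fintype X] [Fintype Z] [Fintype α] [Fintype β] [Fintype γ] {n : ℕ}
  {μ ν : Type*} [Fintype μ] [Fintype ν] {T : Fin n → X → Z → ℝ} {x : μ → ν → Fin n → X}

lemma ent_messages [Nonempty μ] [Nonempty ν] (hT : ∀ i a, T i a ∈ stdSimplex ℝ Z) :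
    Ent (blockLaw T x) Prod.fst = log (Fintype.card μ) + log (Fintype.card ν) := by
  classical
  have h1 : (Fintype.card μ : ℝ) ≠ 0 := by exact_mod_cast Fintype.card_ne_zero
  have h2 : (Fintype.card ν : ℝ) ≠ 0 := by exact_mod_cast Fintype.card_ne_zero
  rw [ent_of_uniform, Fintype.card_prod, Nat.cast_mul, log_mul h1 h2]
  intro m
  have h := sum_blockLaw_mul T x fun ω => if ω.1 = m then 1 else 0
  simp only [mul_ite, mul_one, mul_zero] at h
  rw [prob_eq_sum, h, Finset.sum_eq_single m]
  · simp [sum_prod_eq_one hT]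
  · intro m' _ hm; simp [hm]
  · simp

lemma ent_common [Nonempty μ] [Nonempty ν] (hT : ∀ i a, T i a ∈ stdSimplex ℝ Z) :
    Ent (blockLaw T x) (fun ω => ω.1.1) = log (Fintype.card μ) := by
  classical
  have h1 : (Fintype.card μ : ℝ) ≠ 0 := by exact_mod_cast Fintype.card_ne_zero
  have h2 : (Fintype.card ν : ℝ) ≠ 0 := by exact_mod_cast Fintype.card_ne_zero
  rw [ent_of_uniform]
  intro m
  have h := sum_blockLaw_mul T x fun ω => if ω.1.1 = m then 1 else 0
  simp only [mul_ite, mul_one, mul_zero] at h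
  rw [prob_eq_sum, h, Fintype.sum_prod_type, Finset.sum_eq_single m]
  · have h3 : ∀ w : ν, ∑ z : Fin n → Z, ∏ i, T i (x m w i) (z i) = 1 := fun w =>
      sum_prod_eq_one hT (m, w)
    simp only [if_true, h3, Finset.sum_const, Finset.card_univ, nsmul_eq_mul]
    field_simp
  · intro m' _ hm; simp [hm]
  · simp

lemma before_length_eq_iff (a : Z → α) (ω ω' : (μ × ν) × (Fin n → Z)) :
    before a n ω = before a n ω' ↔ (fun i => a (ω.2 i)) = fun i => a (ω'.2 i) := by
  rw [before_eq_iff, funext_iff]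
  exact ⟨fun h j => h j j.2, fun h j _ => h j⟩

lemma after_zero_eq_iff (a : Z → α) (ω ω' : (μ × ν) × (Fin n → Z)) :
    after a 0 ω = after a 0 ω' ↔ (fun i => a (ω.2 i)) = fun i => a (ω'.2 i) := by
  rw [after_eq_iff, funext_iff]
  exact ⟨fun h j => h j (Nat.zero_le _), fun h j _ => h j⟩

lemma sum_prob_mul_chanMI {Ω : Type*} [Fintype Ω] {P : Ω → ℝ} (hP : ∀ ω, 0 ≤ P ω) (Y : Ω → X)
    (F : Ω → γ) (K : X → α → ℝ) :
    ∑ f, prob P F f * chanMI K (condLaw P Y F f) =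
      ∑ f, prob P F f * massEnt (outLaw K (condLaw P Y F f)) -
        ∑ t, prob P Y t * massEnt (K t) := by
  simp only [chanMI, mul_sub, Finset.sum_sub_distrib]
  rw [sum_prob_mul_sum_condLaw hP]

lemma ent_block_le {P : (μ × ν) × (Fin n → Z) → ℝ} (hP : P ∈ stdSimplex ℝ _) (a : Z → α) :
    Ent P (before a n) ≤ ∑ i : Fin n, Ent P (outputAt a i) := by
  have h := ent_before_chain P a fun _ => ()
  have h1 : Ent P (pair (fun _ => ()) (before a n)) = Ent P (before a n) :=
    ent_congr P fun ω ω' => by simp [pair]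
  have h2 : Ent P (fun _ => ()) = 0 := by simp [Ent, massEnt, prob, hP.2]
  rw [h1, h2, sub_zero] at h
  rw [h]
  exact Finset.sum_le_sum fun i _ => ent_pair_le hP _ _

/-- The converse for a block code over the channels `T i`, where the observation `b` is a function
of the observation `a`. -/
theorem block_converse [Nonempty μ] [Nonempty ν] (hT : ∀ i t, T i t ∈ stdSimplex ℝ Z)
    (a : Z → α) (b : Z → β) (c : Z → γ) (e : α → β) (hb : ∀ z, b z = e (a z))
    (d₁ : (Fin n → α) → μ × ν) (d₂ : (Fin n → β) → μ) (d₃ : (Fin n → γ) → μ) (ε : ℝ)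
    (herr : ∑ ω, (open Classical in if d₁ (fun i => a (ω.2 i)) ≠ ω.1 ∨
      d₂ (fun i => b (ω.2 i)) ≠ ω.1.1 ∨ d₃ (fun i => c (ω.2 i)) ≠ ω.1.1 then blockLaw T x ω
      else 0) ≤ ε) :
    ∃ z : Fin n → (X → ℝ) × ℝ × ℝ × ℝ × ℝ,
      (∀ i, z i ∈ outerHull (chanMI (mapChan (T i) a))
        (fun p => massEnt (outLaw (mapChan (T i) b) p))
        (fun p => massEnt (outLaw (mapChan (T i) c) p))) ∧
      (1 - ε) * log (Fintype.card μ) - log 2 ≤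
        ∑ i, (massEnt (outLaw (mapChan (T i) b) (z i).1) - (z i).2.2.1) ∧
      (1 - ε) * log (Fintype.card μ) - log 2 ≤
        ∑ i, (massEnt (outLaw (mapChan (T i) c) (z i).1) - (z i).2.2.2.2) ∧
      (1 - ε) * log (Fintype.card ν) - log 2 ≤ ∑ i, (z i).2.1 ∧
      (1 - ε) * (log (Fintype.card μ) + log (Fintype.card ν)) - 2 * log 2 ≤
        ∑ i, (massEnt (outLaw (mapChan (T i) c) (z i).1) - (z i).2.2.2.2 + (z i).2.2.2.1) ∧
      (1 - ε) * (log (Fintype.card μ) + log (Fintype.card ν)) - 2 * log 2 ≤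
        ∑ i, chanMI (mapChan (T i) a) (z i).1 := by
  classical
  set P := blockLaw T x with hPdef
  have hP : P ∈ stdSimplex ℝ _ := blockLaw_mem hT
  set M₀ : (μ × ν) × (Fin n → Z) → μ := fun ω => ω.1.1 with hM₀
  set M₁ : (μ × ν) × (Fin n → Z) → ν := fun ω => ω.1.2 with hM₁
  -- The auxiliary variables. Neither contains the output at time `i`, which the single-letter
  -- formulas require (`hUupd`, `hUVupd`).
  set U : Fin n → (μ × ν) × (Fin n → Z) → μ × (Fin n → Option α) :=
    fun i => pair M₀ (before a i) with hU
  set V : Fin n → (μ × ν) × (Fin n → Z) → (Fin n → Option γ) := fun i => after c (i + 1) with hV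
  set D : Fin n → ℝ := fun i => ∑ t, prob P (inputAt x i) t * massEnt (mapChan (T i) a t) with hD
  have hUupd : ∀ i m z y, U i (m, Function.update z i y) = U i (m, z) := fun i m z y => by
    simp only [hU, hM₀, pair, before_update]
  have hUVupd : ∀ i m z y, pair (U i) (V i) (m, Function.update z i y) = pair (U i) (V i) (m, z) :=
    fun i m z y => by simp only [pair, hUupd, hV, after_update]
  refine ⟨fun i => (prob P (inputAt x i), _, _, _, _),
    fun i => mem_outerHull_of_prob hP (inputAt x i) (U i) (V i), ?_⟩
  -- From here the goal is turned from hull coordinates into conditional entropies of the outputs,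
  -- with `D i` the common noise term.
  simp only [sum_prob_mul_chanMI hP.1]
  simp only [hPdef]
  simp only [← ent_outputAt_cond hT _ _ (hUupd _), ← ent_outputAt_cond hT _ _ (hUVupd _),
    ← ent_outputAt hT, chanMI]
  simp only [← hPdef]
  have hMM : Ent P Prod.fst = log (Fintype.card μ) + log (Fintype.card ν) := ent_messages hT
  have hM : Ent P M₀ = log (Fintype.card μ) := ent_common hT
  have fano₂ : Ent P (pair M₀ (before b n)) - Ent P (before b n) ≤
      log 2 + ε * log (Fintype.card μ) := by
    have h := ent_fano hP M₀ (fun ω i => b (ω.2 i)) d₂ ε ((Finset.sum_le_sum fun ω _ => ?_).trans herr)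
    · have h1 : Ent P (fun ω i => b (ω.2 i)) = Ent P (before b n) :=
        ent_congr P fun ω ω' => by rw [before_length_eq_iff]
      have h2 : Ent P (pair M₀ fun ω i => b (ω.2 i)) = Ent P (pair M₀ (before b n)) :=
        ent_congr P fun ω ω' => by simp only [pair, Prod.mk.injEq, before_length_eq_iff]
      rwa [h1, h2] at h
    · by_cases h : d₂ (fun i => b (ω.2 i)) = ω.1.1
      · simp only [hM₀, h, if_true]; split_ifs <;> simp [hP.1 ω]
      · simp [hM₀, h, hPdef]
  have fano₃ : Ent P (pair M₀ (after c 0)) - Ent P (after c 0) ≤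
      log 2 + ε * log (Fintype.card μ) := by
    have h := ent_fano hP M₀ (fun ω i => c (ω.2 i)) d₃ ε ((Finset.sum_le_sum fun ω _ => ?_).trans herr)
    · have h1 : Ent P (fun ω i => c (ω.2 i)) = Ent P (after c 0) :=
        ent_congr P fun ω ω' => by rw [after_zero_eq_iff]
      have h2 : Ent P (pair M₀ fun ω i => c (ω.2 i)) = Ent P (pair M₀ (after c 0)) :=
        ent_congr P fun ω ω' => by simp only [pair, Prod.mk.injEq, after_zero_eq_iff]
      rwa [h1, h2] at h
    · by_cases h : d₃ (fun i => c (ω.2 i)) = ω.1.1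
      · simp only [hM₀, h, if_true]; split_ifs <;> simp [hP.1 ω]
      · simp [hM₀, h, hPdef]
  -- The common message is kept as side information, so that this bounds the loss in the private
  -- message alone.
  have fano₁ : Ent P (pair Prod.fst (before a n)) - Ent P (pair M₀ (before a n)) ≤
      log 2 + ε * log (Fintype.card ν) := by
    have h := ent_fano hP M₁ (pair M₀ fun ω i => a (ω.2 i)) (fun q => (d₁ q.2).2) ε
      ((Finset.sum_le_sum fun ω _ => ?_).trans herr)
    · have h1 : Ent P (pair M₀ fun ω i => a (ω.2 i)) = Ent P (pair M₀ (before a n)) :=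
        ent_congr P fun ω ω' => by simp only [pair, Prod.mk.injEq, before_length_eq_iff]
      have h2 : Ent P (pair M₁ (pair M₀ fun ω i => a (ω.2 i))) =
          Ent P (pair Prod.fst (before a n)) :=
        ent_congr P fun ω ω' => by
          simp only [pair, before_length_eq_iff, Prod.ext_iff, hM₀, hM₁]
          tauto
      rwa [h1, h2] at h
    · by_cases h : d₁ (fun i => a (ω.2 i)) = ω.1
      · simp only [pair, hM₁, h, if_true]; split_ifs <;> simp [hP.1 ω]
      · rw [if_pos (Or.inl h)]
        split_ifs
        · exact hP.1 ω
        · exact le_rfl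
  have ha := ent_block_le hP a
  have hbn := ent_block_le hP b
  have hcn : Ent P (after c 0) ≤ ∑ i : Fin n, Ent P (outputAt c i) := by
    rw [show Ent P (after c 0) = Ent P (before c n) from
      ent_congr P fun ω ω' => by simp [after_eq_iff, before_eq_iff]]
    exact ent_block_le hP c
  have chain_all : Ent P (pair Prod.fst (before a n)) - Ent P Prod.fst = ∑ i, D i := by
    rw [ent_before_chain]
    exact Finset.sum_congr rfl fun i _ => ent_outputAt_messages hT a i
  have chain_a : Ent P (pair M₀ (before a n)) - Ent P M₀ =
      ∑ i, (Ent P (pair (outputAt a i) (U i)) - Ent P (U i)) := ent_before_chain P a M₀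
  -- The past of `b` is a function of the past of `a`, so conditioning on `U i` is conditioning on
  -- more.
  have chain_b : ∑ i, (Ent P (pair (outputAt b i) (U i)) - Ent P (U i)) ≤
      Ent P (pair M₀ (before b n)) - Ent P M₀ := by
    rw [ent_before_chain]
    refine Finset.sum_le_sum fun i _ => ent_cond_antitone hP.1 _ fun ω ω' h => ?_
    simp only [hU, pair, Prod.mk.injEq, before_eq_iff, hb] at h ⊢
    exact ⟨h.1, fun j hj => by rw [h.2 j hj]⟩
  have chain_c : ∑ i, (Ent P (pair (outputAt c i) (pair (U i) (V i))) - Ent P (pair (U i) (V i))) ≤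
      Ent P (pair M₀ (after c 0)) - Ent P M₀ := by
    rw [ent_after_chain]
    refine Finset.sum_le_sum fun i _ => ent_cond_antitone hP.1 _ fun ω ω' h => ?_
    simp only [hU, hV, pair, Prod.mk.injEq] at h ⊢
    exact ⟨h.1.1, h.2⟩
  have csiszar := csiszar_sum P a c M₀
  -- A receiver seeing `a` is at least as certain of the common message as one seeing `b`; together
  -- with `fano₂` this yields the bound on the sum of the rates by I(X; `a`).
  have degraded : Ent P (pair M₀ (before a n)) - Ent P (before a n) ≤
      Ent P (pair M₀ (before b n)) - Ent P (before b n) := by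
    refine ent_cond_antitone hP.1 _ fun ω ω' h => ?_
    rw [before_eq_iff] at h ⊢
    exact fun j hj => by rw [hb, hb, h j hj]
  simp only [Finset.sum_sub_distrib, Finset.sum_add_distrib] at *
  refine ⟨?_, ?_, ?_, ?_, ?_⟩ <;> linarith
end Block

/-! ### One hull point per state, from a code to the capacity region. -/

lemma exists_concave_average {E S I : Type*} [AddCommGroup E] [Module ℝ E] [Fintype S] [Fintype I]
    [DecidableEq S] {L : S → Set E} (hL : ∀ s, (L s).Nonempty) (hconv : ∀ s, Convex ℝ (L s))
    {w : I → ℝ} (hw : ∀ i, 0 ≤ w i) (st : I → S) {z : I → E} (hz : ∀ i, z i ∈ L (st i)) :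
    ∃ l : S → E, (∀ s, l s ∈ L s) ∧ ∀ G : S → E → ℝ, (∀ s, ConcaveOn ℝ (L s) (G s)) →
      ∑ i, w i * G (st i) (z i) ≤ ∑ s, (∑ i with st i = s, w i) * G s (l s) := by
  set W : S → ℝ := fun s => ∑ i with st i = s, w i with hW
  have key : ∀ s, ∃ y ∈ L s, ∀ g : E → ℝ, ConcaveOn ℝ (L s) g →
      ∑ i with st i = s, w i * g (z i) ≤ W s * g y := by
    intro s
    -- A state of weight 0 contributes nothing and takes an arbitrary point; otherwise the
    -- barycentre works for all concave functions at once, by Jensen's inequality.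
    by_cases h : W s = 0
    · obtain ⟨y, hy⟩ := hL s
      refine ⟨y, hy, fun g _ => ?_⟩
      have h0 := (Finset.sum_eq_zero_iff_of_nonneg fun i _ => hw i).1 h
      rw [h, zero_mul, Finset.sum_eq_zero fun i hi => by rw [h0 i hi, zero_mul]]
    · have hpos : 0 < W s := (Finset.sum_nonneg fun i _ => hw i).lt_of_ne' h
      have h1 : ∀ i ∈ Finset.univ.filter (fun i => st i = s), 0 ≤ w i / W s :=
        fun i _ => div_nonneg (hw i) hpos.le
      have h2 : ∑ i with st i = s, w i / W s = 1 := by rw [← Finset.sum_div, div_self h]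
      have h3 : ∀ i ∈ Finset.univ.filter (fun i => st i = s), z i ∈ L s :=
        fun i hi => (Finset.mem_filter.1 hi).2 ▸ hz i
      refine ⟨∑ i with st i = s, (w i / W s) • z i, (hconv s).sum_mem h1 h2 h3, fun g hg => ?_⟩
      have h4 := mul_le_mul_of_nonneg_left (hg.le_map_sum h1 h2 h3) hpos.le
      refine le_trans (le_of_eq ?_) h4
      rw [Finset.mul_sum]
      refine Finset.sum_congr rfl fun i _ => ?_
      rw [smul_eq_mul]
      field_simp
  choose l hl hl' using key
  refine ⟨l, hl, fun G hG => ?_⟩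
  rw [← Finset.sum_fiberwise (s := Finset.univ) (g := st)]
  refine Finset.sum_le_sum fun s _ => ?_
  refine le_trans (le_of_eq (Finset.sum_congr rfl fun i hi => ?_)) (hl' s (G s) (hG s))
  rw [(Finset.mem_filter.1 hi).2]

end InfoTheory

namespace MultilevelBC

open InfoTheory Real

variable {X S Y₁ Y₂ Y₃ : Type*} [Fintype X] [Fintype S] [Fintype Y₁] [Fintype Y₂] [Fintype Y₃]

/-- The channel from the input to all the outputs, in state `s`. -/
def outChan (ch : MultilevelBC X S Y₁ Y₂ Y₃) (s : S) (x : X) (y : Y₁ × Y₂ × Y₃) : ℝ :=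
  ch.p13 x s (y.1, y.2.2) * ch.p2 y.1 y.2.1

lemma outChan_mem (ch : MultilevelBC X S Y₁ Y₂ Y₃) (s : S) (x : X) :
    ch.outChan s x ∈ stdSimplex ℝ (Y₁ × Y₂ × Y₃) := by
  refine ⟨fun y => mul_nonneg ((ch.p13_mem x s).1 _) ((ch.p2_mem _).1 _), ?_⟩
  rw [← (ch.p13_mem x s).2]
  simp only [Fintype.sum_prod_type, outChan]
  refine Finset.sum_congr rfl fun y₁ _ => ?_
  rw [Finset.sum_comm]
  refine Finset.sum_congr rfl fun y₃ _ => ?_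
  rw [← Finset.mul_sum, (ch.p2_mem y₁).2, mul_one]

/-- The channel to the outputs `Y₁`, `Y₂`, in state `s`. -/
def chan12 (ch : MultilevelBC X S Y₁ Y₂ Y₃) (s : S) : X → Y₁ × Y₂ → ℝ :=
  mapChan (ch.outChan s) fun y => (y.1, y.2.1)

/-- The channel to the output `Y₂`, in state `s`. -/
def chan2 (ch : MultilevelBC X S Y₁ Y₂ Y₃) (s : S) : X → Y₂ → ℝ :=
  mapChan (ch.outChan s) fun y => y.2.1

/-- The channel to the output `Y₃`, in state `s`. -/
def chan3 (ch : MultilevelBC X S Y₁ Y₂ Y₃) (s : S) : X → Y₃ → ℝ :=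
  mapChan (ch.outChan s) fun y => y.2.2

lemma mapChan_outChan_nonneg {α : Type*} (ch : MultilevelBC X S Y₁ Y₂ Y₃) (s : S)
    (a : Y₁ × Y₂ × Y₃ → α) (x : X) (y : α) : 0 ≤ mapChan (ch.outChan s) a x y :=
  prob_nonneg (ch.outChan_mem s x).1 a y

/-- The points `(p, E I(X;Y₁), E H(Y₂), E I(X;Y₁), E H(Y₃))` that auxiliary random variables `U`
(second and third entry) and `U`, `V` (last two entries) give in state `s`. -/
def stateHull (ch : MultilevelBC X S Y₁ Y₂ Y₃) (s : S) : Set ((X → ℝ) × ℝ × ℝ × ℝ × ℝ) :=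
  outerHull (chanMI (ch.chan12 s)) (fun p => massEnt (outLaw (ch.chan2 s) p))
    (fun p => massEnt (outLaw (ch.chan3 s) p))

/-- `I(U; Y₂ | S)`, in nats. -/
def infoUY2 (ch : MultilevelBC X S Y₁ Y₂ Y₃) (l : S → (X → ℝ) × ℝ × ℝ × ℝ × ℝ) : ℝ :=
  ∑ s, ch.pS s * (massEnt (outLaw (ch.chan2 s) (l s).1) - (l s).2.2.1)

/-- `I(UV; Y₃ | S)`, in nats. -/
def infoUVY3 (ch : MultilevelBC X S Y₁ Y₂ Y₃) (l : S → (X → ℝ) × ℝ × ℝ × ℝ × ℝ) : ℝ :=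
  ∑ s, ch.pS s * (massEnt (outLaw (ch.chan3 s) (l s).1) - (l s).2.2.2.2)

/-- `I(X; Y₁ | US)`, in nats. -/
def infoXY1U (ch : MultilevelBC X S Y₁ Y₂ Y₃) (l : S → (X → ℝ) × ℝ × ℝ × ℝ × ℝ) : ℝ :=
  ∑ s, ch.pS s * (l s).2.1

/-- `I(UV; Y₃ | S) + I(X; Y₁ | UVS)`, in nats. -/
def infoSum (ch : MultilevelBC X S Y₁ Y₂ Y₃) (l : S → (X → ℝ) × ℝ × ℝ × ℝ × ℝ) : ℝ :=
  ∑ s, ch.pS s * (massEnt (outLaw (ch.chan3 s) (l s).1) - (l s).2.2.2.2 + (l s).2.2.2.1)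

/-- `I(X; Y₁ | S)`, in nats. -/
def infoXY1 (ch : MultilevelBC X S Y₁ Y₂ Y₃) (l : S → (X → ℝ) × ℝ × ℝ × ℝ × ℝ) : ℝ :=
  ∑ s, ch.pS s * chanMI (ch.chan12 s) (l s).1

lemma concaveOn_stateHull_fst (ch : MultilevelBC X S Y₁ Y₂ Y₃) (s : S) {f : (X → ℝ) → ℝ}
    (hf : ConcaveOn ℝ (stdSimplex ℝ X) f) : ConcaveOn ℝ (ch.stateHull s) fun z => f z.1 :=
  (hf.comp_linearMap (LinearMap.fst ℝ (X → ℝ) (ℝ × ℝ × ℝ × ℝ))).subset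
    (fun _ hz => fst_mem_of_mem_outerHull hz) convex_outerHull

lemma concaveOn_stateHull_linear (ch : MultilevelBC X S Y₁ Y₂ Y₃) (s : S)
    {f : (X → ℝ) × ℝ × ℝ × ℝ × ℝ → ℝ} (hf : IsLinearMap ℝ f) : ConcaveOn ℝ (ch.stateHull s) f :=
  (hf.mk' f).concaveOn convex_outerHull

lemma isCompact_stateHull (ch : MultilevelBC X S Y₁ Y₂ Y₃) (s : S) :
    IsCompact (ch.stateHull s) :=
  isCompact_outerHull (continuous_chanMI _) (continuous_outEnt _) (continuous_outEnt _)

lemma pSn_nonneg (ch : MultilevelBC X S Y₁ Y₂ Y₃) {n : ℕ} (σ : Fin n → S) : 0 ≤ ch.pSn σ :=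
  Finset.prod_nonneg fun i _ => ch.pS_mem.1 (σ i)

lemma sum_pSn (ch : MultilevelBC X S Y₁ Y₂ Y₃) (n : ℕ) : ∑ σ : Fin n → S, ch.pSn σ = 1 := by
  have h := Finset.prod_univ_sum (fun _ : Fin n => Finset.univ) fun _ s => ch.pS s
  simp only [Fintype.piFinset_univ, ch.pS_mem.2, Finset.prod_const_one] at h
  exact h.symm

lemma sum_pSn_coord [DecidableEq S] (ch : MultilevelBC X S Y₁ Y₂ Y₃) {n : ℕ} (i : Fin n) (s : S) :
    ∑ σ : Fin n → S, (if σ i = s then ch.pSn σ else 0) = ch.pS s := by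
  have h := sum_prod_mul_coord (fun (_ : Fin n) s => ch.pS s) i ch.pS_mem.2 (fun _ => 1)
    (fun _ _ => rfl) fun t => if t = s then 1 else 0
  have h1 := ch.sum_pSn n
  simp only [pSn] at h1 ⊢
  simpa [h1] using h

open Classical in
/-- The probability of error given the state sequence. -/
def stateError (ch : MultilevelBC X S Y₁ Y₂ Y₃) {n M₀ M₁ : ℕ}
    (c : MultilevelCode X S Y₁ Y₂ Y₃ n M₀ M₁) (σ : Fin n → S) : ℝ :=
  ∑ ω : (Fin M₀ × Fin M₁) × (Fin n → Y₁ × Y₂ × Y₃),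
    if c.dec₁ (fun i => (ω.2 i).1) σ ≠ ω.1 ∨ c.dec₂ (fun i => (ω.2 i).2.1) σ ≠ ω.1.1 ∨
      c.dec₃ (fun i => (ω.2 i).2.2) σ ≠ ω.1.1 then
      blockLaw (fun i => ch.outChan (σ i)) (fun m₀ m₁ => c.enc m₀ m₁ σ) ω
    else 0

lemma sum_arrow_prod {n : ℕ} (f : (Fin n → Y₁) → (Fin n → Y₂) → (Fin n → Y₃) → ℝ) :
    ∑ z : Fin n → Y₁ × Y₂ × Y₃, f (fun i => (z i).1) (fun i => (z i).2.1) (fun i => (z i).2.2) =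
      ∑ y₁, ∑ y₂, ∑ y₃, f y₁ y₂ y₃ := by
  classical
  rw [← (Equiv.arrowProdEquivProdArrow (Fin n) (fun _ => Y₁) (fun _ => Y₂ × Y₃)).symm.sum_comp,
    Fintype.sum_prod_type]
  refine Finset.sum_congr rfl fun y₁ _ => ?_
  rw [← (Equiv.arrowProdEquivProdArrow (Fin n) (fun _ => Y₂) (fun _ => Y₃)).symm.sum_comp,
    Fintype.sum_prod_type]
  rfl

/-- The state is independent of the messages, so the average over it can be taken last; each
`stateError` is the error of a code over a fixed sequence of channels. -/
lemma errorProb_eq (ch : MultilevelBC X S Y₁ Y₂ Y₃) {n M₀ M₁ : ℕ}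
    (c : MultilevelCode X S Y₁ Y₂ Y₃ n M₀ M₁) :
    ch.errorProb c = ∑ σ, ch.pSn σ * ch.stateError c σ := by
  classical
  have h1 : ∀ σ, ch.stateError c σ = 1 / ((M₀ : ℝ) * M₁) * ∑ m₀ : Fin M₀, ∑ m₁ : Fin M₁,
      ∑ y₁ : Fin n → Y₁, ∑ y₂ : Fin n → Y₂, ∑ y₃ : Fin n → Y₃,
      if c.dec₁ y₁ σ ≠ (m₀, m₁) ∨ c.dec₂ y₂ σ ≠ m₀ ∨ c.dec₃ y₃ σ ≠ m₀ then
        ch.pYn (c.enc m₀ m₁ σ) σ y₁ y₂ y₃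
      else 0 := by
    intro σ
    rw [stateError, Fintype.sum_prod_type, Fintype.sum_prod_type, Finset.mul_sum]
    refine Finset.sum_congr rfl fun m₀ _ => ?_
    rw [Finset.mul_sum]
    refine Finset.sum_congr rfl fun m₁ _ => ?_
    rw [← sum_arrow_prod, Finset.mul_sum]
    refine Finset.sum_congr rfl fun z _ => ?_
    simp only [blockLaw, Fintype.card_fin, outChan, pYn, mul_ite, mul_zero]
  have h2 : ∀ (k : ℝ) (F : Fin M₀ → Fin M₁ → (Fin n → S) → ℝ),
      k * ∑ m₀, ∑ m₁, ∑ σ, ch.pSn σ * F m₀ m₁ σ =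
        ∑ σ, ch.pSn σ * (k * ∑ m₀, ∑ m₁, F m₀ m₁ σ) := by
    intro k F
    simp only [Finset.mul_sum]
    symm
    rw [Finset.sum_comm]
    refine Finset.sum_congr rfl fun m₀ _ => ?_
    rw [Finset.sum_comm]
    exact Finset.sum_congr rfl fun m₁ _ => Finset.sum_congr rfl fun σ _ => by ring
  simp only [h1]
  rw [← h2, errorProb]

/-- The converse for a code: it gives a point of every state hull. -/
theorem code_converse (ch : MultilevelBC X S Y₁ Y₂ Y₃) {n M₀ M₁ : ℕ} (hn : 0 < n) (hM₀ : 0 < M₀)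
    (hM₁ : 0 < M₁) (c : MultilevelCode X S Y₁ Y₂ Y₃ n M₀ M₁) :
    ∃ l : S → (X → ℝ) × ℝ × ℝ × ℝ × ℝ, (∀ s, l s ∈ ch.stateHull s) ∧
      (1 - ch.errorProb c) * log M₀ - log 2 ≤ n * ch.infoUY2 l ∧
      (1 - ch.errorProb c) * log M₀ - log 2 ≤ n * ch.infoUVY3 l ∧
      (1 - ch.errorProb c) * log M₁ - log 2 ≤ n * ch.infoXY1U l ∧
      (1 - ch.errorProb c) * (log M₀ + log M₁) - 2 * log 2 ≤ n * ch.infoSum l ∧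
      (1 - ch.errorProb c) * (log M₀ + log M₁) - 2 * log 2 ≤ n * ch.infoXY1 l := by
  classical
  have : NeZero M₀ := ⟨hM₀.ne'⟩
  have : NeZero M₁ := ⟨hM₁.ne'⟩
  have hS : Nonempty S := by
    by_contra h
    rw [not_nonempty_iff] at h
    have := ch.pS_mem.2
    simp at this
  have hX : Nonempty X := ⟨c.enc 0 0 (fun _ => Classical.arbitrary S) ⟨0, hn⟩⟩
  -- The strong receiver observes the pair (Y₁, Y₂), of which Y₂ is literally the second entry; its
  -- decoder ignores Y₂.
  have hblock := fun σ : Fin n → S => block_converse (T := fun i => ch.outChan (σ i))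
    (x := fun m₀ m₁ => c.enc m₀ m₁ σ) (fun i t => ch.outChan_mem (σ i) t)
    (fun y => (y.1, y.2.1)) (fun y => y.2.1) (fun y => y.2.2) Prod.snd (fun _ => rfl)
    (fun y => c.dec₁ (fun i => (y i).1) σ) (fun y => c.dec₂ y σ) (fun y => c.dec₃ y σ)
    (ch.stateError c σ) (le_of_eq (by unfold stateError; congr!))
  choose z hz hz1 hz2 hz3 hz4 hz5 using hblock
  obtain ⟨l, hl, hG⟩ := exists_concave_average (L := ch.stateHull) (I := (Fin n → S) × Fin n)
    (fun _ => outerHull_nonempty) (fun _ => convex_outerHull) (w := fun i => ch.pSn i.1)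
    (fun i => ch.pSn_nonneg i.1) (fun i => i.1 i.2) (z := fun i => z i.1 i.2) (fun i => hz i.1 i.2)
  -- The expected number of times at which the state equals `s`.
  have hweight : ∀ s, ∑ i : (Fin n → S) × Fin n with i.1 i.2 = s, ch.pSn i.1 = n * ch.pS s := by
    intro s
    rw [Finset.sum_filter, Fintype.sum_prod_type_right]
    simp [sum_pSn_coord]
  simp only [hweight] at hG
  -- The Fano bound is affine in the error probability, so averaging over `σ` produces exactly
  -- `ch.errorProb c`.
  have havg : ∀ (A B : ℝ) (G : S → (X → ℝ) × ℝ × ℝ × ℝ × ℝ → ℝ),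
      (∀ s, ConcaveOn ℝ (ch.stateHull s) (G s)) →
      (∀ σ, (1 - ch.stateError c σ) * A - B ≤ ∑ i, G (σ i) (z σ i)) →
      (1 - ch.errorProb c) * A - B ≤ n * ∑ s, ch.pS s * G s (l s) := by
    intro A B G hc h
    calc (1 - ch.errorProb c) * A - B
        = ∑ σ, ch.pSn σ * ((1 - ch.stateError c σ) * A - B) := by
          have e1 : ∀ σ, ch.pSn σ * ((1 - ch.stateError c σ) * A - B) =
              ch.pSn σ * (A - B) - ch.pSn σ * ch.stateError c σ * A := fun σ => by ring
          simp only [e1, Finset.sum_sub_distrib]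
          rw [← Finset.sum_mul, ← Finset.sum_mul, sum_pSn, ← errorProb_eq]
          ring
      _ ≤ ∑ σ, ch.pSn σ * ∑ i, G (σ i) (z σ i) :=
          Finset.sum_le_sum fun σ _ => mul_le_mul_of_nonneg_left (h σ) (ch.pSn_nonneg σ)
      _ = ∑ i : (Fin n → S) × Fin n, ch.pSn i.1 * G (i.1 i.2) (z i.1 i.2) := by
          rw [Fintype.sum_prod_type]
          simp only [Finset.mul_sum]
      _ ≤ _ := hG G hc
      _ = _ := by simp only [Finset.mul_sum, mul_assoc]
  simp only [Fintype.card_fin] at hz1 hz2 hz3 hz4 hz5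
  -- Only the first coordinate of a hull point enters the bounds nonlinearly, and there concavely.
  have lin1 : IsLinearMap ℝ fun z : (X → ℝ) × ℝ × ℝ × ℝ × ℝ => z.2.1 := ⟨by simp, by simp⟩
  have lin2 : IsLinearMap ℝ fun z : (X → ℝ) × ℝ × ℝ × ℝ × ℝ => -z.2.2.1 :=
    ⟨fun _ _ => by simp; ring, by simp⟩
  have lin3 : IsLinearMap ℝ fun z : (X → ℝ) × ℝ × ℝ × ℝ × ℝ => -z.2.2.2.2 :=
    ⟨fun _ _ => by simp; ring, by simp⟩
  have lin4 : IsLinearMap ℝ fun z : (X → ℝ) × ℝ × ℝ × ℝ × ℝ => -z.2.2.2.2 + z.2.2.2.1 :=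
    ⟨fun _ _ => by simp; ring, fun _ _ => by simp; ring⟩
  have c2 := fun s => ch.concaveOn_stateHull_fst s
    (concaveOn_outEnt (ch.mapChan_outChan_nonneg s fun y => y.2.1))
  have c3 := fun s => ch.concaveOn_stateHull_fst s
    (concaveOn_outEnt (ch.mapChan_outChan_nonneg s fun y => y.2.2))
  refine ⟨l, hl,
    havg _ _ (fun s z => massEnt (outLaw (ch.chan2 s) z.1) - z.2.2.1) (fun s => ?_) hz1,
    havg _ _ (fun s z => massEnt (outLaw (ch.chan3 s) z.1) - z.2.2.2.2) (fun s => ?_) hz2,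
    havg _ _ (fun _ z => z.2.1) (fun s => ch.concaveOn_stateHull_linear s lin1) hz3,
    havg _ _ (fun s z => massEnt (outLaw (ch.chan3 s) z.1) - z.2.2.2.2 + z.2.2.2.1)
      (fun s => ?_) hz4,
    havg _ _ (fun s z => chanMI (ch.chan12 s) z.1) (fun s => ch.concaveOn_stateHull_fst s
      (concaveOn_chanMI (ch.mapChan_outChan_nonneg s fun y => (y.1, y.2.1)))) hz5⟩
  · simp only [sub_eq_add_neg]
    exact (c2 s).add (ch.concaveOn_stateHull_linear s lin2)
  · simp only [sub_eq_add_neg]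
    exact (c3 s).add (ch.concaveOn_stateHull_linear s lin3)
  · simp only [sub_eq_add_neg, add_assoc]
    exact (c3 s).add (ch.concaveOn_stateHull_linear s lin4)

/-- A rate pair of the capacity region satisfies the rate inequalities at a point of the state
hulls. -/
theorem exists_stateHull_of_mem_capacityRegion (ch : MultilevelBC X S Y₁ Y₂ Y₃) {R₀ R₁ : ℝ}
    (hR : (R₀, R₁) ∈ ch.capacityRegion) :
    ∃ l : S → (X → ℝ) × ℝ × ℝ × ℝ × ℝ, (∀ s, l s ∈ ch.stateHull s) ∧
      R₀ * log 2 ≤ ch.infoUY2 l ∧ R₀ * log 2 ≤ ch.infoUVY3 l ∧ R₁ * log 2 ≤ ch.infoXY1U l ∧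
      (max R₀ 0 + R₁) * log 2 ≤ ch.infoSum l ∧ (R₀ + R₁) * log 2 ≤ ch.infoXY1 l := by
  -- A pair of the region may have negative `R₀`. A code has at least one common message, so the
  -- bounds hold with the positive part too, which is needed for the second bound on `R₁`.
  set r := max R₀ 0 with hr
  have hlog2 : 0 < log 2 := log_pos one_lt_two
  -- In `2 * ε` one `ε` is the distance to an achievable pair and the other the rate slack of its
  -- codes. The term `ε * log 2` absorbs Fano's `log 2 / n`, as `n` is at least 1/ε.
  have approx : ∀ ε : ℝ, 0 < ε → ε < 1 → ∃ l : S → (X → ℝ) × ℝ × ℝ × ℝ × ℝ,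
      (∀ s, l s ∈ ch.stateHull s) ∧
      (1 - ε) * ((r - 2 * ε) * log 2) - ε * log 2 ≤ ch.infoUY2 l ∧
      (1 - ε) * ((r - 2 * ε) * log 2) - ε * log 2 ≤ ch.infoUVY3 l ∧
      (1 - ε) * ((R₁ - 2 * ε) * log 2) - ε * log 2 ≤ ch.infoXY1U l ∧
      (1 - ε) * ((r - 2 * ε) * log 2 + (R₁ - 2 * ε) * log 2) - 2 * (ε * log 2) ≤ ch.infoSum l ∧
      (1 - ε) * ((r - 2 * ε) * log 2 + (R₁ - 2 * ε) * log 2) - 2 * (ε * log 2) ≤ ch.infoXY1 l := by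
    intro ε hε hε1
    obtain ⟨R', hR', hdist⟩ := Metric.mem_closure_iff.1 (hR ε hε) ε hε
    rw [Prod.dist_eq, max_lt_iff, Real.dist_eq, Real.dist_eq, abs_lt, abs_lt] at hdist
    simp only at hdist
    obtain ⟨n₀, hn₀⟩ := hR' ε hε
    obtain ⟨N, hN⟩ := exists_nat_ge (1 / ε)
    set n := max n₀ (max N 1) with hn
    have hn1 : 1 ≤ n := (le_max_right _ _).trans (le_max_right _ _)
    have hnpos : (0 : ℝ) < n := by exact_mod_cast hn1
    have hnε : 1 / (n : ℝ) ≤ ε := by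
      rw [div_le_iff₀ hnpos, mul_comm, ← div_le_iff₀ hε]
      exact hN.trans (by exact_mod_cast (le_max_left _ _).trans (le_max_right _ _))
    obtain ⟨M₀, M₁, h0, h1, c, hc⟩ := hn₀ n (le_max_left _ _)
    have hM₀ : (0 : ℝ) < M₀ := lt_of_lt_of_le (by positivity) h0
    have hM₁ : (0 : ℝ) < M₁ := lt_of_lt_of_le (by positivity) h1
    have hM₀' : 0 < M₀ := by exact_mod_cast hM₀
    have hM₁' : 0 < M₁ := by exact_mod_cast hM₁
    have hl₀ : 0 ≤ log M₀ := log_nonneg (by exact_mod_cast hM₀')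
    have hl₁ : 0 ≤ log M₁ := log_nonneg (by exact_mod_cast hM₁')
    obtain ⟨l, hl, g1, g2, g3, g4, g5⟩ := ch.code_converse hn1 hM₀' hM₁' c
    have k0 : (n : ℝ) * (R'.1 - ε) * log 2 ≤ log M₀ := by
      have := log_le_log (by positivity) h0
      rwa [log_rpow two_pos] at this
    have k1 : (n : ℝ) * (R'.2 - ε) * log 2 ≤ log M₁ := by
      have := log_le_log (by positivity) h1
      rwa [log_rpow two_pos] at this
    have q0 : (r - 2 * ε) * log 2 ≤ log M₀ / n := by
      rw [le_div_iff₀ hnpos]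
      rcases max_cases R₀ 0 with ⟨h, _⟩ | ⟨h, _⟩ <;> rw [← hr] at h <;> rw [h]
      · refine le_trans ?_ k0
        have := mul_le_mul_of_nonneg_right (show R₀ - 2 * ε ≤ R'.1 - ε by linarith)
          (mul_pos hlog2 hnpos).le
        linarith
      · refine le_trans ?_ hl₀
        have : 0 ≤ ε * log 2 * n := by positivity
        linarith
    have q1 : (R₁ - 2 * ε) * log 2 ≤ log M₁ / n := by
      rw [le_div_iff₀ hnpos]
      refine le_trans ?_ k1
      have := mul_le_mul_of_nonneg_right (show R₁ - 2 * ε ≤ R'.2 - ε by linarith)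
        (mul_pos hlog2 hnpos).le
      linarith
    have q2 : log 2 / n ≤ ε * log 2 := by
      rw [div_eq_mul_one_div, mul_comm]
      gcongr
    have bound : ∀ {A a B b G : ℝ}, 0 ≤ A → (1 - ch.errorProb c) * A - B ≤ n * G → a ≤ A / n →
        B / n ≤ b → (1 - ε) * a - b ≤ G := by
      intro A a B b G hA h ha hb
      have e1 : (1 - ε) * A - B ≤ n * G :=
        le_trans (by gcongr) h
      have e2 : (1 - ε) * (A / n) - B / n ≤ G := by
        rw [← mul_div_assoc, ← sub_div, div_le_iff₀ hnpos]
        linarith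
      have e3 : (1 - ε) * a ≤ (1 - ε) * (A / n) := mul_le_mul_of_nonneg_left ha (by linarith)
      linarith
    have q3 : (r - 2 * ε) * log 2 + (R₁ - 2 * ε) * log 2 ≤ (log M₀ + log M₁) / n := by
      rw [add_div]; exact add_le_add q0 q1
    have q4 : 2 * log 2 / n ≤ 2 * (ε * log 2) := by
      rw [mul_div_assoc]; linarith
    exact ⟨l, hl, bound hl₀ g1 q0 q2, bound hl₀ g2 q0 q2, bound hl₁ g3 q1 q2,
      bound (add_nonneg hl₀ hl₁) g4 q3 q4, bound (add_nonneg hl₀ hl₁) g5 q3 q4⟩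
  -- The shift by 2 keeps every `ε k` below 1.
  set ε : ℕ → ℝ := fun k => 1 / ((k : ℝ) + 2) with hεdef
  have hε0 : ∀ k, 0 < ε k := fun k => by positivity
  have hε1 : ∀ k, ε k < 1 := fun k => by
    rw [hεdef]
    simp only
    rw [div_lt_one (by positivity)]
    have : (0 : ℝ) ≤ k := k.cast_nonneg
    linarith
  choose l hl g1 g2 g3 g4 g5 using fun k => approx (ε k) (hε0 k) (hε1 k)
  -- Compactness of the product of the state hulls gives a limit point, and all five bounds are
  -- continuous.
  obtain ⟨a, ha, φ, hφ, hlim⟩ := (isCompact_univ_pi ch.isCompact_stateHull).tendsto_subseq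
    (x := l) fun k s _ => hl k s
  have hεlim : Filter.Tendsto (fun k => ε (φ k)) Filter.atTop (nhds 0) := by
    refine Filter.Tendsto.comp (g := ε) ?_ hφ.tendsto_atTop
    refine tendsto_const_nhds.div_atTop ?_
    exact Filter.tendsto_atTop_add_const_right _ _ tendsto_natCast_atTop_atTop
  have limit : ∀ {F : ℝ → ℝ} {G : (S → (X → ℝ) × ℝ × ℝ × ℝ × ℝ) → ℝ}, Continuous F → Continuous G →
      (∀ k, F (ε k) ≤ G (l k)) → F 0 ≤ G a := fun hF hG h =>
    le_of_tendsto_of_tendsto' ((hF.tendsto 0).comp hεlim) ((hG.tendsto a).comp hlim)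
      fun k => h (φ k)
  have e2 : ∀ s, Continuous fun l : S → (X → ℝ) × ℝ × ℝ × ℝ × ℝ =>
      massEnt (outLaw (ch.chan2 s) (l s).1) :=
    fun s => (continuous_outEnt _).comp (by fun_prop)
  have e3 : ∀ s, Continuous fun l : S → (X → ℝ) × ℝ × ℝ × ℝ × ℝ =>
      massEnt (outLaw (ch.chan3 s) (l s).1) :=
    fun s => (continuous_outEnt _).comp (by fun_prop)
  have e1 : ∀ s, Continuous (chanMI (ch.chan12 s)) := fun s => continuous_chanMI _
  have c1 : Continuous ch.infoUY2 := by unfold infoUY2; fun_prop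
  have c2 : Continuous ch.infoUVY3 := by unfold infoUVY3; fun_prop
  have c3 : Continuous ch.infoXY1U := by unfold infoXY1U; fun_prop
  have c4 : Continuous ch.infoSum := by unfold infoSum; fun_prop
  have c5 : Continuous ch.infoXY1 := by unfold infoXY1; fun_prop
  have f1 := limit (F := fun ε => (1 - ε) * ((r - 2 * ε) * log 2) - ε * log 2) (by fun_prop) c1 g1
  have f2 := limit (F := fun ε => (1 - ε) * ((r - 2 * ε) * log 2) - ε * log 2) (by fun_prop) c2 g2
  have f3 := limit (F := fun ε => (1 - ε) * ((R₁ - 2 * ε) * log 2) - ε * log 2) (by fun_prop) c3 g3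
  have f4 := limit (F := fun ε => (1 - ε) * ((r - 2 * ε) * log 2 + (R₁ - 2 * ε) * log 2) -
    2 * (ε * log 2)) (by fun_prop) c4 g4
  have f5 := limit (F := fun ε => (1 - ε) * ((r - 2 * ε) * log 2 + (R₁ - 2 * ε) * log 2) -
    2 * (ε * log 2)) (by fun_prop) c5 g5
  have hRr : R₀ * log 2 ≤ r * log 2 := mul_le_mul_of_nonneg_right (le_max_left _ _) hlog2.le
  refine ⟨a, fun s => ha s trivial, ?_, ?_, ?_, ?_, ?_⟩ <;> linarith

end MultilevelBC

/-! ### Conditional output entropies of a joint law given by a channel. -/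

namespace InfoTheory

open Real

variable {Ω α β γ : Type*} [Fintype Ω] [Fintype α] [Fintype β] [Fintype γ]

/-- The conditional output entropy given a function `κ` of the variables `A` that determine the
law of the output `Y`. -/
lemma ent_pair_comp {P : Ω → ℝ} {A : Ω → α} {Y : Ω → β} {Q : α → ℝ} {K : α → β → ℝ}
    (hK : ∀ a, ∑ y, K a y = 1) (h : ∀ a y, prob P (pair Y A) (y, a) = Q a * K a y)
    [DecidableEq γ] (κ : α → γ) (k : γ → β → ℝ) (hk : ∀ c, ∑ y, k c y = 1)
    (hκ : ∀ c y, ∑ a, (if κ a = c then Q a * K a y else 0) =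
      (∑ a, if κ a = c then Q a else 0) * k c y) :
    Ent P (pair Y fun ω => κ (A ω)) - Ent P (fun ω => κ (A ω)) =
      ∑ a, Q a * massEnt (k (κ a)) := by
  classical
  have hQ : ∀ a, prob P A a = Q a := fun a => by
    rw [← sum_prob_pair_left P Y A a]
    simp only [h, ← Finset.mul_sum, hK, mul_one]
  rw [ent_pair_of_channel P (fun ω => κ (A ω)) Y k hk]
  · rw [sum_prob_mul P (fun ω => κ (A ω)) fun c => massEnt (k c),
      ← sum_prob_mul P A fun a => massEnt (k (κ a))]
    simp only [hQ]
  · intro c y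
    rw [prob_comp P A κ c]
    simp only [hQ]
    rw [← hκ]
    have h1 := prob_comp P (pair Y A) (fun b => (b.1, κ b.2)) (y, c)
    simp only [pair] at h1 h
    change prob P (fun ω => (Y ω, κ (A ω))) (y, c) = _
    rw [h1, Fintype.sum_prod_type_right]
    refine Finset.sum_congr rfl fun a _ => ?_
    simp only [Prod.mk.injEq, ite_and]
    rw [Finset.sum_ite_eq' Finset.univ y]
    simp [h]

end InfoTheory

namespace MultilevelBC

open InfoTheory Real

variable {X S Y₁ Y₂ Y₃ : Type*} [Fintype X] [Fintype S] [Fintype Y₁] [Fintype Y₂] [Fintype Y₃]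

/-- The channel to the output `Y₁`, in state `s`. -/
def chan1 (ch : MultilevelBC X S Y₁ Y₂ Y₃) (s : S) : X → Y₁ → ℝ :=
  mapChan (ch.outChan s) fun y => y.1

/-- Given Y₁, the output Y₂ is pure noise. This returns from the pair (Y₁, Y₂) used in the converse
to Y₁. -/
lemma chanMI_chan12 (ch : MultilevelBC X S Y₁ Y₂ Y₃) (s : S) (p : X → ℝ) :
    chanMI (ch.chan12 s) p = chanMI (ch.chan1 s) p := by
  classical
  rw [← chanMI_degraded (ch.chan1 s) (fun y => (ch.p2_mem y).2)]
  congr 1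
  funext x y
  obtain ⟨y₁, y₂⟩ := y
  have h1 : ch.chan1 s x y₁ = ∑ y₃, ch.p13 x s (y₁, y₃) := by
    rw [chan1, mapChan, prob_eq_sum]
    simp only [Fintype.sum_prod_type, outChan]
    rw [Finset.sum_eq_single y₁ (fun b _ hb => by simp [hb]) (by simp)]
    simp only [if_true]
    rw [Finset.sum_comm]
    refine Finset.sum_congr rfl fun y₃ _ => ?_
    rw [← Finset.mul_sum, (ch.p2_mem y₁).2, mul_one]
  rw [chan12, mapChan, prob_eq_sum, h1]
  simp only [Fintype.sum_prod_type, outChan]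
  rw [Finset.sum_eq_single y₁ (fun b _ hb => by simp [hb]) (by simp),
    Finset.sum_eq_single y₂ (fun b _ hb => by simp [hb]) (by simp)]
  simp only [if_true, Finset.sum_mul]

/-! ### The informations of the constructed U, V, X, read off from the hull point. -/

section Decode

variable {kU kV : ℕ} (wU : S → Fin kU → ℝ) (wV : S → Fin kU → Fin kV → ℝ)
  (p : S → Fin kU → Fin kV → X → ℝ)

/-- The conditional laws with a trivial variable `W`. -/
def auxLaw (hU : ∀ s, wU s ∈ stdSimplex ℝ (Fin kU)) (hV : ∀ s u, wV s u ∈ stdSimplex ℝ (Fin kV))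
    (hp : ∀ s u v, p s u v ∈ stdSimplex ℝ X) : AuxLaw S X (Fin kU) (Fin kV) (Fin 1) where
  pUV s := fun x => wU s x.1 * wV s x.1 x.2
  pUV_mem s := ⟨fun x => mul_nonneg ((hU s).1 _) ((hV s _).1 _), by
    simp only [Fintype.sum_prod_type, ← Finset.mul_sum, (hV s _).2, mul_one, (hU s).2]⟩
  pW _ _ _ := fun _ => 1
  pW_mem _ _ _ := ⟨fun _ => zero_le_one, by simp⟩
  pX u v _ s := p s u v
  pX_mem u v _ s := hp s u v

/-- The law of `(S, U, V, X)`. -/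
def inputLaw (ch : MultilevelBC X S Y₁ Y₂ Y₃) (b : S × Fin kU × Fin kV × X) : ℝ :=
  ch.pS b.1 * (wU b.1 b.2.1 * wV b.1 b.2.1 b.2.2.1) * p b.1 b.2.1 b.2.2.1 b.2.2.2

/-- The random variables `(S, U, V, X)`. -/
def inputs (ω : Outcome (Fin kU) (Fin kV) (Fin 1) S X Y₁ Y₂ Y₃) : S × Fin kU × Fin kV × X :=
  (ω.s, ω.u, ω.v, ω.x)

/-- A function of the outputs. -/
def outputs {α : Type*} (a : Y₁ × Y₂ × Y₃ → α)
    (ω : Outcome (Fin kU) (Fin kV) (Fin 1) S X Y₁ Y₂ Y₃) : α := a (ω.y₁, ω.y₂, ω.y₃)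

variable {wU wV p} (hU : ∀ s, wU s ∈ stdSimplex ℝ (Fin kU))
  (hV : ∀ s u, wV s u ∈ stdSimplex ℝ (Fin kV)) (hp : ∀ s u v, p s u v ∈ stdSimplex ℝ X)

lemma joint_nonneg (ch : MultilevelBC X S Y₁ Y₂ Y₃) {U V W : Type*} [Fintype U] [Fintype V]
    [Fintype W] (q : AuxLaw S X U V W) (ω : Outcome U V W S X Y₁ Y₂ Y₃) : 0 ≤ ch.joint q ω :=
  mul_nonneg (mul_nonneg (mul_nonneg (mul_nonneg (mul_nonneg (ch.pS_mem.1 _) ((q.pUV_mem _).1 _))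
    ((q.pW_mem _ _ _).1 _)) ((q.pX_mem _ _ _ _).1 _)) ((ch.p13_mem _ _).1 _)) ((ch.p2_mem _).1 _)

lemma prob_outputs_inputs {α : Type*} (ch : MultilevelBC X S Y₁ Y₂ Y₃) (a : Y₁ × Y₂ × Y₃ → α)
    (b : S × Fin kU × Fin kV × X) (y : α) :
    prob (ch.joint (auxLaw wU wV p hU hV hp)) (pair (outputs a) inputs) (y, b) =
      inputLaw wU wV p ch b * mapChan (ch.outChan b.1) a b.2.2.2 y := by
  classical
  obtain ⟨s, u, v, x⟩ := b
  rw [prob_eq_sum, mapChan, prob_eq_sum]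
  simp only [Fintype.sum_prod_type, pair, outputs, inputs, Outcome.s, Outcome.u, Outcome.v,
    Outcome.x, Outcome.y₁, Outcome.y₂, Outcome.y₃, Prod.mk.injEq]
  rw [Finset.sum_eq_single u (fun b _ hb => by simp [hb]) (by simp),
    Finset.sum_eq_single v (fun b _ hb => by simp [hb]) (by simp),
    Finset.univ_unique, Finset.sum_singleton,
    Finset.sum_eq_single s (fun b _ hb => by simp [hb]) (by simp),
    Finset.sum_eq_single x (fun b _ hb => by simp [hb]) (by simp)]
  simp only [and_true, Finset.mul_sum, mul_ite, mul_zero, joint, auxLaw, inputLaw, outChan, mul_one,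
    mul_assoc]

variable {α : Type*} [Fintype α] (ch : MultilevelBC X S Y₁ Y₂ Y₃) (a : Y₁ × Y₂ × Y₃ → α)

lemma sum_mapChan_outChan (s : S) (x : X) : ∑ y, mapChan (ch.outChan s) a x y = 1 :=
  (prob_mem_stdSimplex (ch.outChan_mem s x) a).2

lemma sum_outLaw {r : X → ℝ} (hr : r ∈ stdSimplex ℝ X) (s : S) :
    ∑ y, outLaw (mapChan (ch.outChan s) a) r y = 1 := by
  simp only [outLaw]
  rw [Finset.sum_comm]
  simp only [← Finset.mul_sum, sum_mapChan_outChan, mul_one, hr.2]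

lemma mean_mem {ι : Type*} [Fintype ι] {w : ι → ℝ} (hw : w ∈ stdSimplex ℝ ι) {r : ι → X → ℝ}
    (hr : ∀ i, r i ∈ stdSimplex ℝ X) : ∑ i, w i • r i ∈ stdSimplex ℝ X :=
  (convex_stdSimplex ℝ X).sum_mem (fun i _ => hw.1 i) hw.2 fun i _ => hr i

/-- Conditioning on the input. -/
lemma ent_outputs_of_input {γ : Type*} [Fintype γ] (κ : S × Fin kU × Fin kV × X → γ)
    (sx : γ → S × X) (hsx : ∀ b, sx (κ b) = (b.1, b.2.2.2)) :
    Ent (ch.joint (auxLaw wU wV p hU hV hp)) (pair (outputs a) fun ω => κ (inputs ω)) -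
      Ent (ch.joint (auxLaw wU wV p hU hV hp)) (fun ω => κ (inputs ω)) =
      ∑ s, ch.pS s * ∑ u, wU s u * ∑ v, wV s u v *
        ∑ x, p s u v x * massEnt (mapChan (ch.outChan s) a x) := by
  classical
  rw [ent_pair_comp (fun b => sum_mapChan_outChan ch a b.1 b.2.2.2)
    (prob_outputs_inputs hU hV hp ch a) κ (fun c => mapChan (ch.outChan (sx c).1) a (sx c).2)
    (fun c => sum_mapChan_outChan ch a _ _)]
  · simp only [hsx, Fintype.sum_prod_type, inputLaw, Finset.mul_sum, mul_assoc]
  · intro c y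
    rw [Finset.sum_mul]
    refine Finset.sum_congr rfl fun b _ => ?_
    by_cases h : κ b = c
    · simp [← h, hsx]
    · simp [h]

lemma outLaw_sum {ι β : Type*} [Fintype ι] (T : X → β → ℝ) (w : ι → ℝ) (r : ι → X → ℝ) (y : β) :
    outLaw T (∑ i, w i • r i) y = ∑ i, w i * outLaw T (r i) y := by
  simp only [outLaw, Finset.sum_apply, Pi.smul_apply, smul_eq_mul, Finset.mul_sum, Finset.sum_mul,
    mul_assoc]
  exact Finset.sum_comm

/-- Conditioning on `S`. -/
lemma ent_outputs_S :
    Ent (ch.joint (auxLaw wU wV p hU hV hp)) (pair (outputs a) Outcome.s) -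
      Ent (ch.joint (auxLaw wU wV p hU hV hp)) Outcome.s =
      ∑ s, ch.pS s * massEnt (outLaw (mapChan (ch.outChan s) a)
        (∑ u, wU s u • ∑ v, wV s u v • p s u v)) := by
  classical
  have h := ent_pair_comp (fun b : S × Fin kU × Fin kV × X => sum_mapChan_outChan ch a b.1 b.2.2.2)
    (prob_outputs_inputs hU hV hp ch a) (fun b => b.1)
    (fun s => outLaw (mapChan (ch.outChan s) a) (∑ u, wU s u • ∑ v, wV s u v • p s u v))
    (fun s => sum_outLaw ch a (mean_mem (hU s) fun u => mean_mem (hV s u) (hp s u)) s) ?_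
  · refine h.trans ?_
    simp only [Fintype.sum_prod_type, inputLaw, ← Finset.sum_mul, ← Finset.mul_sum, (hp _ _ _).2,
      (hV _ _).2, (hU _).2, mul_one]
  · intro s y
    simp only [Fintype.sum_prod_type]
    rw [Finset.sum_eq_single s (fun b _ hb => by simp [hb]) (by simp),
      Finset.sum_eq_single s (fun b _ hb => by simp [hb]) (by simp)]
    simp only [if_true, inputLaw, ← Finset.mul_sum, (hp _ _ _).2, (hV _ _).2, (hU _).2, mul_one,
      outLaw_sum]
    simp only [outLaw, Finset.mul_sum, mul_assoc]

/-- Conditioning on `U`, `S`. -/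
lemma ent_outputs_US :
    Ent (ch.joint (auxLaw wU wV p hU hV hp)) (pair (outputs a) (pair Outcome.u Outcome.s)) -
      Ent (ch.joint (auxLaw wU wV p hU hV hp)) (pair Outcome.u Outcome.s) =
      ∑ s, ch.pS s * ∑ u, wU s u * massEnt (outLaw (mapChan (ch.outChan s) a)
        (∑ v, wV s u v • p s u v)) := by
  classical
  have h := ent_pair_comp (fun b : S × Fin kU × Fin kV × X => sum_mapChan_outChan ch a b.1 b.2.2.2)
    (prob_outputs_inputs hU hV hp ch a) (fun b => (b.2.1, b.1))
    (fun c => outLaw (mapChan (ch.outChan c.2) a) (∑ v, wV c.2 c.1 v • p c.2 c.1 v))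
    (fun c => sum_outLaw ch a (mean_mem (hV c.2 c.1) (hp c.2 c.1)) c.2) ?_
  · refine h.trans ?_
    simp only [Fintype.sum_prod_type, inputLaw, ← Finset.sum_mul, ← Finset.mul_sum, (hp _ _ _).2,
      (hV _ _).2, mul_one]
    simp only [Finset.mul_sum, mul_assoc]
  · rintro ⟨u, s⟩ y
    simp only [Fintype.sum_prod_type, Prod.mk.injEq]
    rw [Finset.sum_eq_single s (fun b _ hb => by simp [hb]) (by simp),
      Finset.sum_eq_single s (fun b _ hb => by simp [hb]) (by simp),
      Finset.sum_eq_single u (fun b _ hb => by simp [hb]) (by simp),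
      Finset.sum_eq_single u (fun b _ hb => by simp [hb]) (by simp)]
    simp only [and_self, if_true, inputLaw, ← Finset.mul_sum, (hp _ _ _).2, (hV _ _).2, mul_one,
      outLaw_sum]
    simp only [outLaw, Finset.mul_sum, mul_assoc]

/-- Conditioning on `U`, `V`, `S`. -/
lemma ent_outputs_UVS :
    Ent (ch.joint (auxLaw wU wV p hU hV hp))
        (pair (outputs a) (pair (pair Outcome.u Outcome.v) Outcome.s)) -
      Ent (ch.joint (auxLaw wU wV p hU hV hp)) (pair (pair Outcome.u Outcome.v) Outcome.s) =
      ∑ s, ch.pS s * ∑ u, wU s u * ∑ v, wV s u v *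
        massEnt (outLaw (mapChan (ch.outChan s) a) (p s u v)) := by
  classical
  have h := ent_pair_comp (fun b : S × Fin kU × Fin kV × X => sum_mapChan_outChan ch a b.1 b.2.2.2)
    (prob_outputs_inputs hU hV hp ch a) (fun b => ((b.2.1, b.2.2.1), b.1))
    (fun c => outLaw (mapChan (ch.outChan c.2) a) (p c.2 c.1.1 c.1.2))
    (fun c => sum_outLaw ch a (hp c.2 c.1.1 c.1.2) c.2) ?_
  · refine h.trans ?_
    simp only [Fintype.sum_prod_type, inputLaw, ← Finset.sum_mul, ← Finset.mul_sum, (hp _ _ _).2,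
      mul_one]
    simp only [Finset.mul_sum, mul_assoc]
  · rintro ⟨⟨u, v⟩, s⟩ y
    simp only [Fintype.sum_prod_type, Prod.mk.injEq]
    rw [Finset.sum_eq_single s (fun b _ hb => by simp [hb]) (by simp),
      Finset.sum_eq_single s (fun b _ hb => by simp [hb]) (by simp),
      Finset.sum_eq_single u (fun b _ hb => by simp [hb]) (by simp),
      Finset.sum_eq_single u (fun b _ hb => by simp [hb]) (by simp),
      Finset.sum_eq_single v (fun b _ hb => by simp [hb]) (by simp),
      Finset.sum_eq_single v (fun b _ hb => by simp [hb]) (by simp)]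
    simp only [and_self, if_true, inputLaw, ← Finset.mul_sum, (hp _ _ _).2, mul_one]
    simp only [outLaw, Finset.mul_sum, mul_assoc]

lemma sum_mean_mul {ι : Type*} [Fintype ι] (w : ι → ℝ) (r : ι → X → ℝ) (m : X → ℝ) :
    ∑ x, (∑ i, w i • r i) x * m x = ∑ i, w i * ∑ x, r i x * m x := by
  simp only [Finset.sum_apply, Pi.smul_apply, smul_eq_mul, Finset.mul_sum, Finset.sum_mul,
    mul_assoc]
  exact Finset.sum_comm

/-- The point `l s` of the state hull is the one that the conditional laws give. -/
def IsHullPoint (wU : S → Fin kU → ℝ) (wV : S → Fin kU → Fin kV → ℝ)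
    (p : S → Fin kU → Fin kV → X → ℝ) (l : S → (X → ℝ) × ℝ × ℝ × ℝ × ℝ) : Prop :=
  ∀ s, l s =
    (∑ u, wU s u • ∑ v, wV s u v • p s u v,
      ∑ u, wU s u * chanMI (ch.chan12 s) (∑ v, wV s u v • p s u v),
      ∑ u, wU s u * massEnt (outLaw (ch.chan2 s) (∑ v, wV s u v • p s u v)),
      ∑ u, wU s u * ∑ v, wV s u v * chanMI (ch.chan12 s) (p s u v),
      ∑ u, wU s u * ∑ v, wV s u v * massEnt (outLaw (ch.chan3 s) (p s u v)))

variable {l : S → (X → ℝ) × ℝ × ℝ × ℝ × ℝ}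

lemma condMI_U_Y2 (hl : ch.IsHullPoint wU wV p l) :
    condMI (ch.joint (auxLaw wU wV p hU hV hp)) Outcome.u Outcome.y₂ Outcome.s * log 2 =
      ch.infoUY2 l := by
  have h1 := ent_outputs_S hU hV hp ch fun y => y.2.1
  have h2 := ent_outputs_US hU hV hp ch fun y => y.2.1
  rw [condMI_mul_log_two (ch.joint_nonneg _)]
  refine (congrArg₂ (· - ·) h1 h2).trans ?_
  simp only [infoUY2, hl _, mul_sub, Finset.sum_sub_distrib, chan2]

lemma condMI_UV_Y3 (hl : ch.IsHullPoint wU wV p l) :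
    condMI (ch.joint (auxLaw wU wV p hU hV hp)) (pair Outcome.u Outcome.v) Outcome.y₃ Outcome.s *
      log 2 = ch.infoUVY3 l := by
  have h1 := ent_outputs_S hU hV hp ch fun y => y.2.2
  have h2 := ent_outputs_UVS hU hV hp ch fun y => y.2.2
  rw [condMI_mul_log_two (ch.joint_nonneg _)]
  refine (congrArg₂ (· - ·) h1 h2).trans ?_
  simp only [infoUVY3, hl _, mul_sub, Finset.sum_sub_distrib, chan3]

lemma condMI_X_Y1_U (hl : ch.IsHullPoint wU wV p l) :
    condMI (ch.joint (auxLaw wU wV p hU hV hp)) Outcome.x Outcome.y₁ (pair Outcome.u Outcome.s) *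
      log 2 = ch.infoXY1U l := by
  have h1 := ent_outputs_US hU hV hp ch fun y => y.1
  have h2 := ent_outputs_of_input hU hV hp ch (fun y => y.1) (fun b => (b.2.2.2, b.2.1, b.1))
    (fun c => (c.2.2, c.1)) fun _ => rfl
  rw [condMI_mul_log_two (ch.joint_nonneg _)]
  refine (congrArg₂ (· - ·) h1 h2).trans ?_
  simp only [infoXY1U, hl _, chanMI_chan12]
  simp only [chanMI, sum_mean_mul, mul_sub, Finset.sum_sub_distrib,
    chan1]

/-- The fourth coordinate of the hull point averages to I(X; Y₁ | UVS), which `infoSum` adds to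
`infoUVY3`. -/
lemma condMI_X_Y1_UV (hl : ch.IsHullPoint wU wV p l) :
    condMI (ch.joint (auxLaw wU wV p hU hV hp)) Outcome.x Outcome.y₁
        (pair (pair Outcome.u Outcome.v) Outcome.s) * log 2 + ch.infoUVY3 l = ch.infoSum l := by
  have h1 := ent_outputs_UVS hU hV hp ch fun y => y.1
  have h2 := ent_outputs_of_input hU hV hp ch (fun y => y.1)
    (fun b => (b.2.2.2, (b.2.1, b.2.2.1), b.1)) (fun c => (c.2.2, c.1)) fun _ => rfl
  rw [condMI_mul_log_two (ch.joint_nonneg _)]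
  refine (congrArg (· + ch.infoUVY3 l) (congrArg₂ (· - ·) h1 h2)).trans ?_
  simp only [infoUVY3, infoSum, hl _, chanMI_chan12]
  simp only [chanMI, mul_add, mul_sub,
    Finset.sum_add_distrib, Finset.sum_sub_distrib, chan1]
  ring

lemma condMI_X_Y1 (hl : ch.IsHullPoint wU wV p l) :
    condMI (ch.joint (auxLaw wU wV p hU hV hp)) Outcome.x Outcome.y₁ Outcome.s * log 2 =
      ch.infoXY1 l := by
  have h1 := ent_outputs_S hU hV hp ch fun y => y.1
  have h2 := ent_outputs_of_input hU hV hp ch (fun y => y.1) (fun b => (b.2.2.2, b.1))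
    (fun c => (c.2, c.1)) fun _ => rfl
  rw [condMI_mul_log_two (ch.joint_nonneg _)]
  refine (congrArg₂ (· - ·) h1 h2).trans ?_
  simp only [infoXY1, hl _, chanMI_chan12]
  simp only [chanMI, sum_mean_mul, mul_sub, Finset.sum_sub_distrib,
    chan1]

end Decode

end MultilevelBC

end

open InfoTheory in
theorem theorem2 {X S Y₁ Y₂ Y₃ : Type*} [Fintype X] [Fintype S] [Fintype Y₁] [Fintype Y₂]
    [Fintype Y₃] (ch : MultilevelBC X S Y₁ Y₂ Y₃) (R₀ R₁ : ℝ)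
    (hR : (R₀, R₁) ∈ ch.capacityRegion) :
    ∃ (kU kV kW : ℕ) (q : AuxLaw S X (Fin kU) (Fin kV) (Fin kW)),
      R₀ ≤ min
          (condMI (ch.joint q) Outcome.u Outcome.y₂ Outcome.s)
          (condMI (ch.joint q) (pair Outcome.u Outcome.v) Outcome.y₃ Outcome.s) ∧
      R₁ ≤ min
          (condMI (ch.joint q) Outcome.x Outcome.y₁ (pair Outcome.u Outcome.s))
          (condMI (ch.joint q) Outcome.x Outcome.y₁ (pair (pair Outcome.u Outcome.v) Outcome.s)
            + condMI (ch.joint q) Outcome.v Outcome.y₃ (pair Outcome.u Outcome.s)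
            + condMI (ch.joint q) Outcome.u Outcome.y₃ Outcome.s) ∧
      R₀ + R₁ ≤ min
          (condMI (ch.joint q) Outcome.x Outcome.y₁ Outcome.s)
          (condMI (ch.joint q) Outcome.x Outcome.y₁ (pair (pair Outcome.u Outcome.v) Outcome.s)
            + condMI (ch.joint q) (pair Outcome.u Outcome.v) Outcome.y₃ Outcome.s
            + condMI (ch.joint q) Outcome.u Outcome.y₁ Outcome.s) := by
  obtain ⟨l, hl, h1, h2, h3, h4, h5⟩ := ch.exists_stateHull_of_mem_capacityRegion hR
  obtain ⟨kU, kV, wU, wV, p, hU, hV, hp, hlp⟩ := exists_laws_of_mem_outerHull hl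
  have hlog2 : 0 < Real.log 2 := Real.log_pos one_lt_two
  set q := MultilevelBC.auxLaw wU wV p hU hV hp with hq
  have hP := ch.joint_nonneg q
  have e1 := MultilevelBC.condMI_U_Y2 hU hV hp ch hlp
  have e2 := MultilevelBC.condMI_UV_Y3 hU hV hp ch hlp
  have e3 := MultilevelBC.condMI_X_Y1_U hU hV hp ch hlp
  have e4 := MultilevelBC.condMI_X_Y1_UV hU hV hp ch hlp
  have e5 := MultilevelBC.condMI_X_Y1 hU hV hp ch hlp
  rw [← hq] at e1 e2 e3 e4 e5
  rw [← e2, ← add_mul] at e4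
  have h6 := le_of_mul_le_mul_right (h4.trans_eq e4.symm) hlog2
  have h7 := condMI_chain hP Outcome.u Outcome.v Outcome.y₃ Outcome.s
  have h8 := condMI_nonneg hP Outcome.u Outcome.y₁ Outcome.s
  have h9 := le_max_left R₀ 0
  have h10 := le_max_right R₀ 0
  refine ⟨kU, kV, 1, q, le_min ?_ ?_, le_min ?_ ?_, le_min ?_ ?_⟩
  · exact le_of_mul_le_mul_right (h1.trans_eq e1.symm) hlog2
  · exact le_of_mul_le_mul_right (h2.trans_eq e2.symm) hlog2
  · exact le_of_mul_le_mul_right (h3.trans_eq e3.symm) hlog2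
  -- By the chain rule `h7` the right side is the Csiszár sum bound, which dominates `max R₀ 0 + R₁`
  -- and hence `R₁`.
  · linarith
  · exact le_of_mul_le_mul_right (h5.trans_eq e5.symm) hlog2
  -- The same bound dominates `R₀ + R₁`, and I(U; Y₁ | S) is nonnegative.
  · linarith
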